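/- Let $\Bbbk$ be a field of characteristic different from $2$. Let $\mathbb{J}$ be a super-cocommutative Hopf superalgebra over $\Bbbk$ (a Hopf algebra in the category of $\mathbb{Z}/2$-graded vector spaces with symmetry $v\otimes w\mapsto(-1)^{|v||w|}w\otimes v$, whose coproduct is invariant under this symmetry), and let $\mathbb{K}\hookrightarrow\mathbb{J}$ be a Hopf sub-superalgebra. Let $J=\Delta_{\mathbb{J}}^{-1}(\mathbb{J}_0\otimes\mathbb{J}_0)$ and $K=\Delta_{\mathbb{K}}^{-1}(\mathbb{K}_0\otimes\mathbb{K}_0)$ be the largest purely even Hopf sub-superalgebras; they are ordinary cocommutative Hopf algebras, and $K\subset J$. Let $$\mathsf{V}_{\mathbb{J}}=\{v\in\mathbb{J}_1\mid \Delta(v)=1\otimes v+v\otimes 1\},\qquad \mathsf{V}_{\mathbb{K}}=\{v\in\mathbb{K}_1\mid \Delta(v)=1\otimes v+v\otimes 1\}$$ be the spaces of odd primitive elements. They are right $K$-modules under the adjoint action $v\triangleleft c=S(c_{(1)})\,v\,c_{(2)}$, and $\mathsf{V}_{\mathbb{K}}$ is a $K$-submodule of $\mathsf{V}_{\mathbb{J}}$;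 put $\mathsf{Q}=\mathsf{V}_{\mathbb{J}}/\mathsf{V}_{\mathbb{K}}$. Let $\mathsf{Mod}_K^J$ be the category of right $J$-comodules in the monoidal category of right $K$-modules: its objects are right $K$-modules $M$ with a right $J$-comodule structure $m\mapsto m^{(0)}\otimes m^{(1)}$ such that $(mc)^{(0)}\otimes(mc)^{(1)}=m^{(0)}c_{(1)}\otimes m^{(1)}c_{(2)}$ for $m\in M$, $c\in K$, and its morphisms are the $K$-linear and $J$-colinear maps. For a right $K$-module $W$, regard $J\otimes W$ as an object of $\mathsf{Mod}_K^J$ with the diagonal action $(a\otimes w)c=ac_{(1)}\otimes wc_{(2)}$ and the coaction $a\otimes w\mapsto(a_{(1)}\otimes w)\otimes a_{(2)}$. Then the short exact sequence $$0\to J\otimes\mathsf{V}_{\mathbb{K}}\to J\otimes\mathsf{V}_{\mathbb{J}}\to J\otimes\mathsf{Q}\to 0$$ in $\mathsf{Mod}_K^J$ splits in $\mathsf{Mod}_K^J$. Moreover, if a morphism $p:M\to N$ in $\mathsf{Mod}_K^J$ has a $J$-colinear ($\Bbbk$-linear) section, then $p$ has a section in $\mathsf{Mod}_K^J$. -/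

import Mathlib

open scoped TensorProduct

universe v u

noncomputable section

/-! ### Right actions -/

section Actions

open TensorProduct Coalgebra

variable {k : Type v} [Field k] {K : Type u} [Ring K] [Bialgebra k K]

/-- `op a ↦ op a₁ ⊗ op a₂`, for an ordinary bialgebra `H`. -/
def comulOp (k : Type v) (H : Type u) [Field k] [Ring H] [Bialgebra k H] :
    Hᵐᵒᵖ →ₐ[k] Hᵐᵒᵖ ⊗[k] Hᵐᵒᵖ :=
  (Algebra.TensorProduct.opAlgEquiv k k H H).symm.toAlgHom.comp
    (AlgHom.op (Bialgebra.comulAlgHom k H))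

theorem comulOp_apply (a : K) : comulOp k K (.op a) =
    map (MulOpposite.opLinearEquiv k).toLinearMap (MulOpposite.opLinearEquiv k).toLinearMap
      (comul (R := k) a) := rfl

/-- The restriction of a right action along a bialgebra map. -/
def restrictAction {J M : Type u} [Ring J] [Bialgebra k J] [AddCommGroup M] [Module k M]
    (φ : K →ₐc[k] J) (ρ : Jᵐᵒᵖ →ₐ[k] Module.End k M) : Kᵐᵒᵖ →ₐ[k] Module.End k M :=
  ρ.comp (AlgHom.op (φ : K →ₐ[k] J))

theorem restrictAction_apply {J M : Type u} [Ring J] [Bialgebra k J] [AddCommGroup M] [Module k M]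
    (φ : K →ₐc[k] J) (ρ : Jᵐᵒᵖ →ₐ[k] Module.End k M) (c : K) :
    restrictAction φ ρ (.op c) = ρ (.op (φ c)) := rfl

/-- The diagonal right action `(m ⊗ n) c = m c₁ ⊗ n c₂` of a bialgebra `K`; right `K`-modules are
presented as algebra maps from `Kᵐᵒᵖ` to the endomorphism algebra of a vector space. -/
def diagonalAction {M N : Type u} [AddCommGroup M] [Module k M] [AddCommGroup N] [Module k N]
    (ρ : Kᵐᵒᵖ →ₐ[k] Module.End k M) (σ : Kᵐᵒᵖ →ₐ[k] Module.End k N) :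
    Kᵐᵒᵖ →ₐ[k] Module.End k (M ⊗[k] N) :=
  (Module.endTensorEndAlgHom.comp (Algebra.TensorProduct.map ρ σ)).comp
    (comulOp k K)

/-- The right `K`-module structure on `J` given by right multiplication through `φ : K → J`. -/
def regularAction {J : Type u} [Ring J] [Bialgebra k J] (φ : K →ₐc[k] J) :
    Kᵐᵒᵖ →ₐ[k] Module.End k J :=
  restrictAction φ (Algebra.lsmul k k J : Jᵐᵒᵖ →ₐ[k] Module.End k J)

theorem regularAction_apply {J : Type u} [Ring J] [Bialgebra k J] (φ : K →ₐc[k] J) (c : K)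
    (a : J) : regularAction φ (.op c) a = a * φ c := rfl

/-- The induced right action on a quotient by a stable subspace. -/
def quotientAction {M : Type u} [AddCommGroup M] [Module k M] (ρ : Kᵐᵒᵖ →ₐ[k] Module.End k M)
    (N : Submodule k M) (hN : ∀ c, N ≤ N.comap (ρ c)) : Kᵐᵒᵖ →ₐ[k] Module.End k (M ⧸ N) :=
  AlgHom.ofLinearMap
    { toFun := fun c => N.mapQ N (ρ c) (hN c)
      map_add' := fun a b => by ext v; simp
      map_smul' := fun r a => by ext v; simp }
    (by ext v; simp)
    (fun a b => by ext v; simp)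

theorem quotientAction_mk {M : Type u} [AddCommGroup M] [Module k M]
    (ρ : Kᵐᵒᵖ →ₐ[k] Module.End k M) (N : Submodule k M) (hN : ∀ c, N ≤ N.comap (ρ c))
    (c : Kᵐᵒᵖ) (m : M) : quotientAction ρ N hN c (N.mkQ m) = N.mkQ (ρ c m) := rfl

/-- The orbit map `c ↦ m c`. -/
def orbitMap {M : Type u} [AddCommGroup M] [Module k M] (ρ : Kᵐᵒᵖ →ₐ[k] Module.End k M) (m : M) :
    K →ₗ[k] M :=
  LinearMap.applyₗ m ∘ₗ ρ.toLinearMap ∘ₗ (MulOpposite.opLinearEquiv k).toLinearMap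

theorem diagonalAction_tmul {M N : Type u} [AddCommGroup M] [Module k M] [AddCommGroup N]
    [Module k N] (ρ : Kᵐᵒᵖ →ₐ[k] Module.End k M) (σ : Kᵐᵒᵖ →ₐ[k] Module.End k N) (c : K)
    (m : M) (n : N) : diagonalAction ρ σ (.op c) (m ⊗ₜ n) =
      map (orbitMap ρ m) (orbitMap σ n) (comul (R := k) c) := by
  simp only [diagonalAction, AlgHom.comp_apply, comulOp_apply]
  generalize comul (R := k) c = x
  induction x with
  | zero => simp
  | add x y hx hy => simp only [map_add, LinearMap.add_apply, hx, hy]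
  | tmul b c => rfl

end Actions

/-! ### Hopf superalgebras -/

/-- A super-cocommutative Hopf superalgebra over the field `k`: a Hopf algebra in the symmetric
monoidal category of `ℤ/2`-graded vector spaces, whose symmetry is
`v ⊗ w ↦ (-1) ^ (|v| |w|) w ⊗ v`, such that the coproduct is invariant under the symmetry.
Coassociativity, the counit axioms and the antipode axioms involve no sign. -/
class HopfSuperalgebra (k : Type v) (A : Type u) [Field k] [Ring A] [Algebra k A]
    extends Coalgebra k A where
  /-- The even component `parity 0` and the odd component `parity 1`. -/
  parity : ZMod 2 → Submodule k A
  [graded : GradedAlgebra parity]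
  /-- The coproduct preserves the parity. -/
  comul_mem_parity (i : ZMod 2) (a : A) (ha : a ∈ parity i) :
    comul a ∈ ⨆ p : ZMod 2,
      LinearMap.range (TensorProduct.mapIncl (parity p) (parity (i - p)))
  /-- The counit preserves the parity, where `k` is purely even. -/
  counit_odd (a : A) (ha : a ∈ parity 1) : counit a = 0
  counit_one : counit 1 = 1
  counit_mul (a b : A) : counit (a * b) = counit a * counit b
  comul_one : comul 1 = 1 ⊗ₜ[k] 1
  /-- The coproduct is multiplicative for the product
  `(a ⊗ b) (c ⊗ d) = (-1) ^ (|b| |c|) a c ⊗ b d` on the super tensor product. -/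
  comul_mul (a b : A) :
    GradedTensorProduct.of k parity parity (comul (a * b)) =
      GradedTensorProduct.of k parity parity (comul a) *
        GradedTensorProduct.of k parity parity (comul b)
  /-- Super-cocommutativity. -/
  comul_cocomm (a : A) :
    GradedTensorProduct.comm parity parity (GradedTensorProduct.of k parity parity (comul a)) =
      GradedTensorProduct.of k parity parity (comul a)
  antipode : A →ₗ[k] A
  antipode_mem_parity (i : ZMod 2) (a : A) (ha : a ∈ parity i) : antipode a ∈ parity i
  mul_antipode_rTensor_comul :
    LinearMap.mul' k A ∘ₗ antipode.rTensor A ∘ₗ comul = Algebra.linearMap k A ∘ₗ counit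
  mul_antipode_lTensor_comul :
    LinearMap.mul' k A ∘ₗ antipode.lTensor A ∘ₗ comul = Algebra.linearMap k A ∘ₗ counit

namespace HopfSuperalgebra

open TensorProduct GradedTensorProduct Coalgebra

variable (k : Type v) (A : Type u) [Field k] [Ring A] [Algebra k A] [HopfSuperalgebra k A]

instance instGradedParity : GradedAlgebra (parity (k := k) (A := A)) := graded

/-- `A₀ ⊗ A₀`, as a subspace of `A ⊗ A`. -/
def evenTensor : Submodule k (A ⊗[k] A) :=
  LinearMap.range (TensorProduct.mapIncl (parity (k := k) (A := A) 0) (parity (k := k) (A := A) 0))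

/-- The projection to the even component. -/
def proj0 : A →ₗ[k] A := GradedAlgebra.proj (parity (k := k) (A := A)) 0

variable {k A}

theorem proj0_of_even {a : A} (ha : a ∈ parity (k := k) (A := A) 0) : proj0 k A a = a := by
  simp [proj0, GradedAlgebra.proj_apply, DirectSum.decompose_of_mem_same _ ha]

theorem proj0_of_odd {a : A} (ha : a ∈ parity (k := k) (A := A) 1) : proj0 k A a = 0 := by
  simp [proj0, GradedAlgebra.proj_apply, DirectSum.decompose_of_mem_ne _ ha one_ne_zero]

theorem proj0_mem (a : A) : proj0 k A a ∈ parity (k := k) (A := A) 0 := by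
  simp [proj0, GradedAlgebra.proj_apply]

theorem proj0_proj0 (a : A) : proj0 k A (proj0 k A a) = proj0 k A a :=
  proj0_of_even (proj0_mem a)

theorem tmul_mem_evenTensor {a b : A} (ha : a ∈ parity (k := k) (A := A) 0)
    (hb : b ∈ parity (k := k) (A := A) 0) : a ⊗ₜ[k] b ∈ evenTensor k A :=
  ⟨⟨a, ha⟩ ⊗ₜ ⟨b, hb⟩, rfl⟩

@[elab_as_elim]
theorem evenTensor_induction {P : A ⊗[k] A → Prop} {x : A ⊗[k] A} (hx : x ∈ evenTensor k A)
    (zero : P 0) (add : ∀ x y, P x → P y → P (x + y))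
    (tmul : ∀ a b, a ∈ parity (k := k) (A := A) 0 → b ∈ parity (k := k) (A := A) 0 →
      P (a ⊗ₜ[k] b)) : P x := by
  obtain ⟨y, rfl⟩ := hx
  induction y with
  | zero => simpa using zero
  | add x y hx hy => rw [map_add]; exact add _ _ hx hy
  | tmul a b => exact tmul _ _ a.2 b.2

theorem map_proj0_mem (x : A ⊗[k] A) : map (proj0 k A) (proj0 k A) x ∈ evenTensor k A := by
  induction x with
  | zero => simp
  | add x y hx hy => rw [map_add]; exact add_mem hx hy
  | tmul a b => exact tmul_mem_evenTensor (proj0_mem a) (proj0_mem b)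

theorem mem_evenTensor_iff (x : A ⊗[k] A) :
    x ∈ evenTensor k A ↔ map (proj0 k A) (proj0 k A) x = x := by
  refine ⟨fun hx => ?_, fun h => h ▸ map_proj0_mem x⟩
  refine evenTensor_induction hx (by simp) (fun x y hx hy => by rw [map_add, hx, hy]) ?_
  intro a b ha hb
  rw [map_tmul, proj0_of_even ha, proj0_of_even hb]

theorem of_mul_right {x : A ⊗[k] A} (hx : x ∈ evenTensor k A) (y : A ⊗[k] A) :
    of k parity parity x * of k (parity (k := k) (A := A)) (parity (k := k) (A := A)) y =
      of k parity parity (x * y) := by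
  refine evenTensor_induction hx (by simp) (fun x y hx hy => ?_) ?_
  · rw [map_add, add_mul, add_mul, map_add, hx, hy]
  · intro a b ha hb
    induction y with
    | zero => simp
    | add x y hx hy => rw [map_add, mul_add, mul_add, map_add, hx, hy]
    | tmul c d =>
      induction c using DirectSum.Decomposition.inductionOn (parity (k := k) (A := A)) with
      | zero => simp
      | add m m' h h' => rw [add_tmul, map_add, mul_add, mul_add, map_add, h, h']
      | homogeneous c =>
        simpa using tmul_zero_coe_mul_coe_tmul (R := k) (parity (k := k) (A := A)) parity
          a ⟨b, hb⟩ c d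

theorem of_mul_left {y : A ⊗[k] A} (hy : y ∈ evenTensor k A) (x : A ⊗[k] A) :
    of k parity parity x * of k (parity (k := k) (A := A)) (parity (k := k) (A := A)) y =
      of k parity parity (x * y) := by
  refine evenTensor_induction hy (by simp) (fun x y hx hy => ?_) ?_
  · rw [map_add, mul_add, mul_add, map_add, hx, hy]
  · intro a b ha hb
    induction x with
    | zero => simp
    | add x y hx hy => rw [map_add, add_mul, add_mul, map_add, hx, hy]
    | tmul c d =>
      induction d using DirectSum.Decomposition.inductionOn (parity (k := k) (A := A)) with
      | zero => simp
      | add m m' h h' => rw [tmul_add, map_add, add_mul, add_mul, map_add, h, h']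
      | homogeneous d =>
        simpa using tmul_coe_mul_zero_coe_tmul (R := k) (parity (k := k) (A := A)) parity
          c d ⟨a, ha⟩ b

theorem mul_mem_evenTensor {x y : A ⊗[k] A} (hx : x ∈ evenTensor k A)
    (hy : y ∈ evenTensor k A) : x * y ∈ evenTensor k A := by
  refine evenTensor_induction hx (by simp) (fun x y hx hy => ?_) ?_
  · rw [add_mul]; exact add_mem hx hy
  · intro a b ha hb
    refine evenTensor_induction hy (by simp) (fun x y hx hy => ?_) ?_
    · rw [mul_add]; exact add_mem hx hy
    · intro c d hc hd
      rw [Algebra.TensorProduct.tmul_mul_tmul]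
      exact tmul_mem_evenTensor (by simpa using SetLike.mul_mem_graded ha hc)
        (by simpa using SetLike.mul_mem_graded hb hd)

theorem comul_mul_of_left {a b : A} (ha : comul a ∈ evenTensor k A) :
    comul (R := k) (a * b) = comul a * comul b := by
  apply (of k (parity (k := k) (A := A)) (parity (k := k) (A := A))).injective
  rw [comul_mul, of_mul_right ha]

theorem comul_mul_of_right {a b : A} (hb : comul b ∈ evenTensor k A) :
    comul (R := k) (a * b) = comul a * comul b := by
  apply (of k (parity (k := k) (A := A)) (parity (k := k) (A := A))).injective
  rw [comul_mul, of_mul_left hb]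

variable (k A) in
/-- The largest purely even sub-super-coalgebra `Δ⁻¹(A₀ ⊗ A₀)` of `A`; it is a subalgebra. -/
def evenPart : Subalgebra k A where
  carrier := {a | comul a ∈ LinearMap.range
    (TensorProduct.mapIncl (parity (k := k) (A := A) 0) (parity (k := k) (A := A) 0))}
  mul_mem' {a b} ha hb := by
    change comul (a * b) ∈ evenTensor k A
    rw [comul_mul_of_left ha]
    exact mul_mem_evenTensor ha hb
  add_mem' {a b} ha hb := by
    change comul (a + b) ∈ evenTensor k A
    rw [map_add]; exact add_mem ha hb
  algebraMap_mem' r := by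
    change comul (algebraMap k A r) ∈ evenTensor k A
    rw [Algebra.algebraMap_eq_smul_one, map_smul, comul_one]
    exact Submodule.smul_mem _ _ (tmul_mem_evenTensor SetLike.GradedOne.one_mem
      SetLike.GradedOne.one_mem)

theorem mem_evenPart {a : A} : a ∈ evenPart k A ↔ comul a ∈ evenTensor k A := Iff.rfl

theorem mem_evenPart_iff {a : A} :
    a ∈ evenPart k A ↔ map (proj0 k A) (proj0 k A) (comul a) = comul a :=
  mem_evenPart.trans (mem_evenTensor_iff _)

theorem even_of_mem_evenPart {a : A} (ha : a ∈ evenPart k A) :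
    a ∈ parity (k := k) (A := A) 0 := by
  have h : ∀ x ∈ evenTensor k A,
      TensorProduct.rid k A (LinearMap.lTensor A counit x) ∈ parity (k := k) (A := A) 0 := by
    intro x hx
    refine evenTensor_induction hx (by simp) (fun x y hx hy => ?_) ?_
    · rw [map_add, map_add]; exact add_mem hx hy
    · intro a b ha hb
      simpa using Submodule.smul_mem _ _ ha
  simpa using h _ ha

theorem zmod2_cases (i : ZMod 2) : i = 0 ∨ i = 1 := by
  revert i; decide

/-- On even elements, applying the even projection to one tensor factor of the coproduct is
the same as applying it to both, since the coproduct preserves the parity. -/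
theorem proj0_comul (b : A) (hb : b ∈ parity (k := k) (A := A) 0) :
    (proj0 k A).rTensor A (comul b) = map (proj0 k A) (proj0 k A) (comul b) ∧
    (proj0 k A).lTensor A (comul b) = map (proj0 k A) (proj0 k A) (comul b) := by
  have h := comul_mem_parity (k := k) (A := A) 0 b hb
  generalize comul (R := k) b = t at h
  induction h using Submodule.iSup_induction' with
  | zero => simp
  | add x y _ _ hx hy => simp only [map_add, hx.1, hx.2, hy.1, hy.2, and_self]
  | mem i x hx =>
    obtain ⟨y, rfl⟩ := hx
    induction y with
    | zero => simp
    | add x y hx hy => simp only [map_add, hx.1, hx.2, hy.1, hy.2, and_self]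
    | tmul c d =>
      obtain ⟨c, hc⟩ := c
      obtain ⟨d, hd⟩ := d
      rcases zmod2_cases i with rfl | rfl
      · have hd' : d ∈ parity (k := k) (A := A) 0 := by simpa using hd
        simp [TensorProduct.mapIncl, proj0_of_even hc, proj0_of_even hd']
      · have hd' : d ∈ parity (k := k) (A := A) 1 := by simpa using hd
        simp [TensorProduct.mapIncl, proj0_of_odd hc, proj0_of_odd hd']

variable (k A) in
/-- The linear map whose kernel is `evenPart k A`. -/
def evenDefect : A →ₗ[k] A ⊗[k] A := map (proj0 k A) (proj0 k A) ∘ₗ comul - comul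

theorem ker_evenDefect :
    LinearMap.ker (evenDefect k A) = Subalgebra.toSubmodule (evenPart k A) := by
  ext a
  simp [evenDefect, sub_eq_zero, mem_evenPart_iff]

theorem evenDefect_rTensor {a : A} (ha : a ∈ evenPart k A) :
    (evenDefect k A).rTensor A (comul a) = 0 := by
  have h1 : (comul.rTensor A) (comul (R := k) a) =
      (TensorProduct.assoc k A A A).symm (comul.lTensor A (comul a)) := by
    rw [← Coalgebra.coassoc_apply]; simp
  have h2 : ∀ x ∈ evenTensor k A,
      (map (proj0 k A) (proj0 k A) ∘ₗ comul).rTensor A x =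
        ((proj0 k A).rTensor A ∘ₗ comul).rTensor A x ∧
      (TensorProduct.assoc k A A A).symm (comul.lTensor A x) =
        ((proj0 k A).rTensor A).rTensor A
          ((TensorProduct.assoc k A A A).symm (comul.lTensor A x)) := by
    intro x hx
    refine evenTensor_induction hx (by simp) (fun x y hx hy => ?_) ?_
    · simp only [map_add]; rw [hx.1, hy.1, ← hx.2, ← hy.2]; exact ⟨rfl, rfl⟩
    · intro b c hb hc
      refine ⟨?_, ?_⟩
      · simp [(proj0_comul b hb).1]
      · simp only [LinearMap.lTensor_tmul]
        generalize comul (R := k) c = y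
        induction y with
        | zero => simp
        | add x y hx hy => simp only [tmul_add, map_add]; rw [← hx, ← hy]
        | tmul d e => simp [proj0_of_even hb]
  rw [evenDefect, LinearMap.rTensor_sub, LinearMap.sub_apply, (h2 _ ha).1, LinearMap.rTensor_comp,
    LinearMap.comp_apply, h1, ← (h2 _ ha).2, sub_self]

theorem evenDefect_lTensor {a : A} (ha : a ∈ evenPart k A) :
    (evenDefect k A).lTensor A (comul a) = 0 := by
  have h1 : (comul.lTensor A) (comul (R := k) a) =
      (TensorProduct.assoc k A A A) (comul.rTensor A (comul a)) := by
    rw [← Coalgebra.coassoc_apply]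
  have h2 : ∀ x ∈ evenTensor k A,
      (map (proj0 k A) (proj0 k A) ∘ₗ comul).lTensor A x =
        ((proj0 k A).lTensor A ∘ₗ comul).lTensor A x ∧
      (TensorProduct.assoc k A A A) (comul.rTensor A x) =
        ((proj0 k A).lTensor A).lTensor A
          ((TensorProduct.assoc k A A A) (comul.rTensor A x)) := by
    intro x hx
    refine evenTensor_induction hx (by simp) (fun x y hx hy => ?_) ?_
    · simp only [map_add]; rw [hx.1, hy.1, ← hx.2, ← hy.2]; exact ⟨rfl, rfl⟩
    · intro b c hb hc
      refine ⟨?_, ?_⟩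
      · simp [(proj0_comul c hc).2]
      · simp only [LinearMap.rTensor_tmul]
        generalize comul (R := k) b = y
        induction y with
        | zero => simp
        | add x y hx hy => simp only [add_tmul, map_add]; rw [← hx, ← hy]
        | tmul d e => simp [proj0_of_even hc]
  rw [evenDefect, LinearMap.lTensor_sub, LinearMap.sub_apply, (h2 _ ha).1, LinearMap.lTensor_comp,
    LinearMap.comp_apply, h1, ← (h2 _ ha).2, sub_self]

variable (k A) in
/-- The inclusion of the largest purely even sub-super-coalgebra. -/
abbrev evenIncl : evenPart k A →ₗ[k] A := (evenPart k A).val.toLinearMap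

theorem exists_evenIncl_retraction : ∃ r : A →ₗ[k] evenPart k A, r ∘ₗ evenIncl k A = .id :=
  (evenIncl k A).exists_leftInverse_of_injective
    (LinearMap.ker_eq_bot.2 Subtype.val_injective)

theorem map_evenIncl_injective :
    Function.Injective (map (evenIncl k A) (evenIncl k A)) := by
  obtain ⟨r, hr⟩ := exists_evenIncl_retraction (k := k) (A := A)
  refine Function.LeftInverse.injective (g := map r r) fun x => ?_
  rw [← LinearMap.comp_apply, ← map_comp, hr, map_id, LinearMap.id_apply]

theorem comul_mem_range {a : A} (ha : a ∈ evenPart k A) :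
    comul (R := k) a ∈ LinearMap.range (map (evenIncl k A) (evenIncl k A)) := by
  obtain ⟨r, hr⟩ := exists_evenIncl_retraction (k := k) (A := A)
  have key1 : (evenIncl k A ∘ₗ r).rTensor A (comul a) = comul (R := k) a := by
    have h := (Module.Flat.rTensor_exact A
      (LinearMap.exact_subtype_ker_map (evenDefect k A)) _).1 (evenDefect_rTensor ha)
    obtain ⟨y, hy⟩ := h
    rw [← hy, ← LinearMap.comp_apply, ← LinearMap.rTensor_comp]
    congr 2
    ext ⟨z, hz⟩
    rw [ker_evenDefect] at hz
    exact congrArg Subtype.val (LinearMap.congr_fun hr ⟨z, hz⟩)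
  have key2 : (evenIncl k A ∘ₗ r).lTensor A (comul a) = comul (R := k) a := by
    have h := (Module.Flat.lTensor_exact A
      (LinearMap.exact_subtype_ker_map (evenDefect k A)) _).1 (evenDefect_lTensor ha)
    obtain ⟨y, hy⟩ := h
    rw [← hy, ← LinearMap.comp_apply, ← LinearMap.lTensor_comp]
    congr 2
    ext ⟨z, hz⟩
    rw [ker_evenDefect] at hz
    exact congrArg Subtype.val (LinearMap.congr_fun hr ⟨z, hz⟩)
  refine ⟨map r r (comul a), ?_⟩
  rw [← LinearMap.comp_apply, ← map_comp, ← LinearMap.rTensor_comp_lTensor, LinearMap.comp_apply,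
    key2, key1]

variable (k A) in
/-- The coproduct of `A` restricted to `evenPart k A`. -/
def evenComul : evenPart k A →ₗ[k] evenPart k A ⊗[k] evenPart k A :=
  (LinearEquiv.ofInjective _ (map_evenIncl_injective (k := k) (A := A))).symm.toLinearMap ∘ₗ
    LinearMap.codRestrict _ (comul ∘ₗ evenIncl k A) fun a => comul_mem_range a.2

theorem map_evenComul (a : evenPart k A) :
    map (evenIncl k A) (evenIncl k A) (evenComul k A a) = comul (a : A) := by
  have := LinearEquiv.apply_symm_apply
    (LinearEquiv.ofInjective _ (map_evenIncl_injective (k := k) (A := A)))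
    (LinearMap.codRestrict _ (comul ∘ₗ evenIncl k A) (fun a => comul_mem_range a.2) a)
  exact congrArg Subtype.val this


instance instCoalgebraEvenPart : Coalgebra k (evenPart k A) where
  comul := evenComul k A
  counit := counit ∘ₗ evenIncl k A
  coassoc := by
    have hinj : Function.Injective
        (map (evenIncl k A) (map (evenIncl k A) (evenIncl k A))) := by
      obtain ⟨r, hr⟩ := exists_evenIncl_retraction (k := k) (A := A)
      refine Function.LeftInverse.injective (g := map r (map r r)) fun x => ?_
      rw [← LinearMap.comp_apply, ← map_comp, ← map_comp, hr, map_id, map_id, LinearMap.id_apply]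
    have hc : map (evenIncl k A) (evenIncl k A) ∘ₗ evenComul k A = comul ∘ₗ evenIncl k A :=
      LinearMap.ext map_evenComul
    ext a
    apply hinj
    have h1 : map (evenIncl k A) (map (evenIncl k A) (evenIncl k A)) ∘ₗ
        (TensorProduct.assoc k _ _ _).toLinearMap =
        (TensorProduct.assoc k A A A).toLinearMap ∘ₗ
          map (map (evenIncl k A) (evenIncl k A)) (evenIncl k A) := by
      ext; rfl
    calc _ = (TensorProduct.assoc k A A A) (map (map (evenIncl k A) (evenIncl k A)) (evenIncl k A)
          ((evenComul k A).rTensor _ (evenComul k A a))) := LinearMap.congr_fun h1 _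
      _ = (TensorProduct.assoc k A A A) (comul.rTensor A
          (map (evenIncl k A) (evenIncl k A) (evenComul k A a))) := by
        rw [← LinearMap.comp_apply, ← LinearMap.comp_apply (comul.rTensor A), LinearMap.rTensor,
          LinearMap.rTensor, ← map_comp, ← map_comp, hc]; rfl
      _ = comul.lTensor A (map (evenIncl k A) (evenIncl k A) (evenComul k A a)) := by
        rw [map_evenComul, Coalgebra.coassoc_apply]
      _ = _ := by
        simp only [LinearMap.comp_apply]
        rw [← LinearMap.comp_apply, ← LinearMap.comp_apply (map _ _), LinearMap.lTensor,
          LinearMap.lTensor, ← map_comp, ← map_comp, hc]; rfl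
  rTensor_counit_comp_comul := by
    ext a
    obtain ⟨r, hr⟩ := exists_evenIncl_retraction (k := k) (A := A)
    have h := congrArg (map LinearMap.id r) (Coalgebra.rTensor_counit_comul (R := k) (a : A))
    rw [← map_evenComul, LinearMap.rTensor, ← LinearMap.comp_apply, ← LinearMap.comp_apply,
      ← map_comp, ← map_comp] at h
    have hra : r (a : A) = a := LinearMap.congr_fun hr a
    rw [LinearMap.comp_apply, LinearMap.rTensor]
    simpa [hr, hra] using h
  lTensor_counit_comp_comul := by
    ext a
    obtain ⟨r, hr⟩ := exists_evenIncl_retraction (k := k) (A := A)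
    have h := congrArg (map r LinearMap.id) (Coalgebra.lTensor_counit_comul (R := k) (a : A))
    rw [← map_evenComul, LinearMap.lTensor, ← LinearMap.comp_apply, ← LinearMap.comp_apply,
      ← map_comp, ← map_comp] at h
    have hra : r (a : A) = a := LinearMap.congr_fun hr a
    rw [LinearMap.comp_apply, LinearMap.lTensor]
    simpa [hr, hra] using h

/-- The coproduct of `evenPart k A` is the restriction of that of `A`. -/
theorem map_evenIncl_comul (a : evenPart k A) :
    map (evenIncl k A) (evenIncl k A) (comul (R := k) a) = comul (a : A) :=
  map_evenComul a

theorem counit_evenPart (a : evenPart k A) : counit (R := k) a = counit (R := k) (a : A) := rfl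

theorem map_evenIncl_mul (x y : evenPart k A ⊗[k] evenPart k A) :
    map (evenIncl k A) (evenIncl k A) (x * y) =
      map (evenIncl k A) (evenIncl k A) x * map (evenIncl k A) (evenIncl k A) y :=
  map_mul (Algebra.TensorProduct.map (evenPart k A).val (evenPart k A).val) x y

instance instBialgebraEvenPart : Bialgebra k (evenPart k A) :=
  Bialgebra.mk' k (evenPart k A) (counit_one (k := k) (A := A))
    (fun {a b} => counit_mul (k := k) (a : A) b)
    (map_evenIncl_injective <| (map_evenIncl_comul 1).trans comul_one)
    (fun {a b} => map_evenIncl_injective <| by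
      rw [map_evenIncl_mul]
      refine (map_evenIncl_comul (a * b)).trans ?_
      rw [map_evenIncl_comul a, map_evenIncl_comul b]
      exact comul_mul_of_left a.2)

theorem comm_of_mem_evenTensor {x : A ⊗[k] A} (hx : x ∈ evenTensor k A) :
    GradedTensorProduct.comm parity parity (of k (parity (k := k) (A := A)) parity x) =
      of k parity parity (TensorProduct.comm k A A x) := by
  refine evenTensor_induction hx (by simp) (fun x y hx hy => ?_) ?_
  · simp only [map_add, hx, hy]
  · intro a b ha hb
    simpa using comm_coe_tmul_coe (R := k) (parity (k := k) (A := A)) parity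
      (⟨a, ha⟩ : parity (k := k) (A := A) 0) (⟨b, hb⟩ : parity (k := k) (A := A) 0)

instance instIsCocommEvenPart : IsCocomm k (evenPart k A) where
  comm_comp_comul := by
    ext a
    apply map_evenIncl_injective
    have h := comul_cocomm (k := k) (a : A)
    rw [comm_of_mem_evenTensor a.2] at h
    have h' := (of k (parity (k := k) (A := A)) (parity (k := k) (A := A))).injective h
    rw [← map_evenIncl_comul] at h'
    rw [← h']
    have h1 : map (evenIncl k A) (evenIncl k A) ∘ₗ (TensorProduct.comm k _ _).toLinearMap =
        (TensorProduct.comm k A A).toLinearMap ∘ₗ map (evenIncl k A) (evenIncl k A) := by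
      ext; rfl
    exact LinearMap.congr_fun h1 _

open WithConv

variable (k A) in
/-- The inclusion of the even part is a coalgebra map. -/
def evenCoalgIncl : evenPart k A →ₗc[k] A where
  toLinearMap := evenIncl k A
  counit_comp := rfl
  map_comp_comul := LinearMap.ext map_evenIncl_comul

theorem antipode_conv_id :
    toConv (antipode (k := k) (A := A)) * toConv LinearMap.id = 1 := by
  apply WithConv.ext
  simpa [LinearMap.convMul_def, LinearMap.convOne_def, LinearMap.rTensor] using
    mul_antipode_rTensor_comul (k := k) (A := A)

theorem id_conv_antipode :
    toConv LinearMap.id * toConv (antipode (k := k) (A := A)) = 1 := by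
  apply WithConv.ext
  simpa [LinearMap.convMul_def, LinearMap.convOne_def, LinearMap.lTensor] using
    mul_antipode_lTensor_comul (k := k) (A := A)

variable (k A) in
/-- The antipode restricted to the even part, with values in `A`. -/
abbrev antipodeEven : evenPart k A →ₗ[k] A := antipode ∘ₗ evenIncl k A

theorem antipodeEven_conv_incl :
    toConv (antipodeEven k A) * toConv (evenIncl k A) = 1 := by
  apply WithConv.ext
  have h := LinearMap.convMul_comp_coalgHom_distrib
    (toConv (antipode (k := k) (A := A))) (toConv LinearMap.id) (evenCoalgIncl k A)
  rw [antipode_conv_id] at h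
  exact h.symm

theorem incl_conv_antipodeEven :
    toConv (evenIncl k A) * toConv (antipodeEven k A) = 1 := by
  apply WithConv.ext
  have h := LinearMap.convMul_comp_coalgHom_distrib
    (toConv LinearMap.id) (toConv (antipode (k := k) (A := A))) (evenCoalgIncl k A)
  rw [id_conv_antipode] at h
  exact h.symm

variable (k A) in
/-- The coproduct of the even part, as a coalgebra map. -/
abbrev evenΔ : evenPart k A →ₗc[k] evenPart k A ⊗[k] evenPart k A :=
  Coalgebra.comulCoalgHom k (evenPart k A)

/-- Convolution products in `A ⊗ A` of maps factoring through the coproduct. -/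
theorem conv_comp_comul (f g f' g' : evenPart k A →ₗ[k] A) :
    toConv (map f g ∘ₗ comul) * toConv (map f' g' ∘ₗ comul) =
      toConv (map (toConv f * toConv f').ofConv (toConv g * toConv g').ofConv ∘ₗ
        comul (R := k) (A := evenPart k A)) := by
  have h := LinearMap.convMul_comp_coalgHom_distrib
    (toConv (map f g)) (toConv (map f' g')) (evenΔ k A)
  apply WithConv.ext
  refine h.symm.trans ?_
  have h2 := TensorProduct.map_convMul_map (f := toConv f) (g := toConv g)
    (h := toConv f') (k := toConv g')
  simp only at h2
  rw [h2]
  rfl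

theorem map_one_comul (f : evenPart k A →ₗ[k] A) (a : evenPart k A) :
    map (1 : WithConv (evenPart k A →ₗ[k] A)).ofConv f (comul a) = 1 ⊗ₜ f a := by
  have h := congrArg (map (Algebra.linearMap k A) f) (Coalgebra.rTensor_counit_comul (R := k) a)
  rw [LinearMap.rTensor, ← LinearMap.comp_apply, ← map_comp] at h
  simpa [LinearMap.convOne_def] using h

theorem map_comul_one (f : evenPart k A →ₗ[k] A) (a : evenPart k A) :
    map f (1 : WithConv (evenPart k A →ₗ[k] A)).ofConv (comul a) = f a ⊗ₜ 1 := by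
  have h := congrArg (map f (Algebra.linearMap k A)) (Coalgebra.lTensor_counit_comul (R := k) a)
  rw [LinearMap.lTensor, ← LinearMap.comp_apply, ← map_comp] at h
  simpa [LinearMap.convOne_def] using h

theorem conv_of_right (f g : evenPart k A →ₗ[k] A ⊗[k] A) (hg : ∀ a, g a ∈ evenTensor k A) :
    toConv ((of k (parity (k := k) (A := A)) parity).toLinearMap ∘ₗ f) *
      toConv ((of k (parity (k := k) (A := A)) parity).toLinearMap ∘ₗ g) =
    toConv ((of k (parity (k := k) (A := A)) parity).toLinearMap ∘ₗ
      (toConv f * toConv g).ofConv) := by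
  ext a
  rw [(ℛ k a).convMul_apply]
  simp only [LinearMap.comp_apply, LinearEquiv.coe_coe]
  rw [(ℛ k a).convMul_apply, map_sum]
  exact Finset.sum_congr rfl fun i _ => of_mul_left (hg _) _

theorem conv_of_left (f g : evenPart k A →ₗ[k] A ⊗[k] A) (hf : ∀ a, f a ∈ evenTensor k A) :
    toConv ((of k (parity (k := k) (A := A)) parity).toLinearMap ∘ₗ f) *
      toConv ((of k (parity (k := k) (A := A)) parity).toLinearMap ∘ₗ g) =
    toConv ((of k (parity (k := k) (A := A)) parity).toLinearMap ∘ₗ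
      (toConv f * toConv g).ofConv) := by
  ext a
  rw [(ℛ k a).convMul_apply]
  simp only [LinearMap.comp_apply, LinearEquiv.coe_coe]
  rw [(ℛ k a).convMul_apply, map_sum]
  exact Finset.sum_congr rfl fun i _ => of_mul_right (hf _) _

theorem antipode_even {a : A} (ha : a ∈ evenPart k A) :
    antipode (k := k) a ∈ parity (k := k) (A := A) 0 :=
  antipode_mem_parity 0 a (even_of_mem_evenPart ha)

theorem map_antipodeEven_mem (x : evenPart k A ⊗[k] evenPart k A) :
    map (antipodeEven k A) (antipodeEven k A) x ∈ evenTensor k A := by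
  induction x with
  | zero => simp
  | add x y hx hy => rw [map_add]; exact add_mem hx hy
  | tmul a b => exact tmul_mem_evenTensor (antipode_even a.2) (antipode_even b.2)

/-- On the (cocommutative) even part the antipode is comultiplicative. -/
theorem comul_antipode (a : evenPart k A) :
    comul (R := k) (antipode (k := k) (a : A)) =
      map (antipodeEven k A) (antipodeEven k A) (comul (R := k) a) := by
  set o := (of k (parity (k := k) (A := A)) (parity (k := k) (A := A))).toLinearMap with ho
  have hD : (comul ∘ₗ evenIncl k A : evenPart k A →ₗ[k] A ⊗[k] A) =
      map (evenIncl k A) (evenIncl k A) ∘ₗ comul :=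
    LinearMap.ext fun a => (map_evenIncl_comul a).symm
  have h1 : toConv (o ∘ₗ comul ∘ₗ antipodeEven k A) * toConv (o ∘ₗ comul ∘ₗ evenIncl k A) = 1 := by
    ext a
    rw [(ℛ k a).convMul_apply]
    have h := congrArg (fun f => o (comul (R := k) (f a)))
      (antipodeEven_conv_incl (k := k) (A := A))
    simp only [(ℛ k a).convMul_apply, map_sum] at h
    refine Eq.trans (Finset.sum_congr rfl fun i _ => ?_) (h.trans ?_)
    · exact (comul_mul (k := k) (A := A) _ _).symm
    · rw [LinearMap.convOne_apply, LinearMap.convOne_apply, Algebra.algebraMap_eq_smul_one,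
        map_smul, map_smul, comul_one, Algebra.algebraMap_eq_smul_one]
      rfl
  have h2 : toConv (o ∘ₗ comul ∘ₗ evenIncl k A) *
      toConv (o ∘ₗ map (antipodeEven k A) (antipodeEven k A) ∘ₗ comul) = 1 := by
    rw [conv_of_right _ _ fun a => map_antipodeEven_mem _, hD, conv_comp_comul,
      incl_conv_antipodeEven]
    ext a
    change o (map (1 : WithConv (evenPart k A →ₗ[k] A)).ofConv
      (1 : WithConv (evenPart k A →ₗ[k] A)).ofConv (comul a)) = _
    rw [map_one_comul]
    change o (1 ⊗ₜ (1 : WithConv (evenPart k A →ₗ[k] A)) a) = _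
    rw [LinearMap.convOne_apply, LinearMap.convOne_apply, Algebra.algebraMap_eq_smul_one,
      Algebra.algebraMap_eq_smul_one, tmul_smul, map_smul]
    rfl
  have h3 := congrArg (fun f => f a) (left_inv_eq_right_inv h1 h2)
  exact (of k (parity (k := k) (A := A)) (parity (k := k) (A := A))).injective h3

theorem antipode_mem_evenPart {a : A} (ha : a ∈ evenPart k A) :
    antipode (k := k) a ∈ evenPart k A := by
  rw [mem_evenPart, comul_antipode ⟨a, ha⟩]
  exact map_antipodeEven_mem _

/-- The even part is an ordinary Hopf algebra. -/
instance instHopfAlgebraEvenPart : HopfAlgebra k (evenPart k A) where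
  antipode := (antipodeEven k A).codRestrict (Subalgebra.toSubmodule (evenPart k A))
    fun a => antipode_mem_evenPart a.2
  mul_antipode_rTensor_comul := by
    ext a
    have h := congrArg (fun f => f a) (antipodeEven_conv_incl (k := k) (A := A))
    simp only [(ℛ k a).convMul_apply, LinearMap.convOne_apply] at h
    refine Eq.trans ?_ h
    simp only [LinearMap.comp_apply]
    conv_lhs => rw [← (ℛ k a).eq]
    simp only [map_sum, AddSubmonoidClass.coe_finsetSum]
    rfl
  mul_antipode_lTensor_comul := by
    ext a
    have h := congrArg (fun f => f a) (incl_conv_antipodeEven (k := k) (A := A))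
    simp only [(ℛ k a).convMul_apply, LinearMap.convOne_apply] at h
    refine Eq.trans ?_ h
    simp only [LinearMap.comp_apply]
    conv_lhs => rw [← (ℛ k a).eq]
    simp only [map_sum, AddSubmonoidClass.coe_finsetSum]
    rfl

variable (k A) in
/-- The odd primitive elements `P(A)₁ = {v ∈ A₁ | Δ(v) = 1 ⊗ v + v ⊗ 1}`. -/
def oddPrimitives : Submodule k A where
  carrier := {v | v ∈ parity (k := k) (A := A) 1 ∧ comul v = 1 ⊗ₜ[k] v + v ⊗ₜ[k] 1}
  add_mem' {v w} hv hw := by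
    refine ⟨add_mem hv.1 hw.1, ?_⟩
    rw [map_add, hv.2, hw.2, tmul_add, add_tmul]; abel
  zero_mem' := ⟨zero_mem _, by simp⟩
  smul_mem' c v hv := by
    refine ⟨Submodule.smul_mem _ _ hv.1, ?_⟩
    rw [map_smul, hv.2, smul_add, tmul_smul, ← smul_tmul']

theorem adjoint_mem (a : evenPart k A) {v : A} (hv : v ∈ oddPrimitives k A) :
    LinearMap.mul' k A (map (antipodeEven k A) (LinearMap.mulLeft k v ∘ₗ evenIncl k A)
      (comul (R := k) a)) ∈ oddPrimitives k A := by
  set o := (of k (parity (k := k) (A := A)) (parity (k := k) (A := A))).toLinearMap with ho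
  set F := antipodeEven k A with hF
  set G := LinearMap.mulLeft k v ∘ₗ evenIncl k A with hG
  have hw : ∀ a, LinearMap.mul' k A (map F G (comul (R := k) a)) = (toConv F * toConv G) a := by
    intro a
    rw [LinearMap.convMul_apply]
  refine ⟨?_, ?_⟩
  · rw [hw, (ℛ k a).convMul_apply]
    refine sum_mem fun i _ => ?_
    have h1 := antipode_even ((ℛ k a).left i).2
    have h2 := even_of_mem_evenPart ((ℛ k a).right i).2
    have := SetLike.mul_mem_graded h1 (SetLike.mul_mem_graded hv.1 h2)
    rwa [zero_add, add_zero] at this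
  · rw [hw]
    have e1 : (o ∘ₗ comul ∘ₗ (toConv F * toConv G).ofConv) =
        (toConv (o ∘ₗ comul ∘ₗ F) * toConv (o ∘ₗ comul ∘ₗ G)).ofConv := by
      ext a
      change o (comul (R := k) ((toConv F * toConv G) a)) = (toConv (o ∘ₗ comul ∘ₗ F) * toConv (o ∘ₗ comul ∘ₗ G)) a
      rw [(ℛ k a).convMul_apply, (ℛ k a).convMul_apply, map_sum, map_sum]
      exact Finset.sum_congr rfl fun i _ => comul_mul (k := k) (A := A) _ _
    have e2 : comul ∘ₗ F = map F F ∘ₗ comul (R := k) (A := evenPart k A) :=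
      LinearMap.ext comul_antipode
    have e3 : comul ∘ₗ G = (map (evenIncl k A) G + map G (evenIncl k A)) ∘ₗ
        comul (R := k) (A := evenPart k A) := by
      ext a
      change comul (R := k) (v * (a : A)) = _
      rw [comul_mul_of_right a.2, hv.2, ← map_evenIncl_comul, LinearMap.comp_apply]
      generalize comul (R := k) a = x
      induction x with
      | zero => simp
      | add x y hx hy => rw [map_add, mul_add, hx, hy, map_add]
      | tmul b c => simp [add_mul, hG]
    rw [e2, e3, conv_of_left _ _ fun a => map_antipodeEven_mem _, LinearMap.add_comp, toConv_add,
      mul_add, conv_comp_comul, conv_comp_comul, antipodeEven_conv_incl] at e1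
    have e4 := LinearMap.congr_fun e1 a
    apply (of k (parity (k := k) (A := A)) (parity (k := k) (A := A))).injective
    refine e4.trans ?_
    change o (map _ _ (comul a) + map _ _ (comul a)) = _
    rw [map_one_comul, map_comul_one]
    rfl

variable (k A) in
/-- The map `op a ↦ (v ↦ S(a) v)`. -/
def antipodeMulLeft : (evenPart k A)ᵐᵒᵖ →ₐ[k] Module.End k A :=
  (Algebra.lmul k A).comp <| (evenPart k A).val.comp <|
    AlgHom.opComm (HopfAlgebra.antipodeAlgHomOp k (evenPart k A))

variable (k A) in
/-- The right adjoint action `v ◁ a = S(a₁) v a₂` of the even part on `A`. -/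
def adjoint : (evenPart k A)ᵐᵒᵖ →ₐ[k] Module.End k A :=
  (Algebra.TensorProduct.lift (antipodeMulLeft k A)
    ((Algebra.lsmul k k A : Aᵐᵒᵖ →ₐ[k] Module.End k A).comp (AlgHom.op (evenPart k A).val))
    (fun _ _ => LinearMap.ext fun _ => (mul_assoc _ _ _).symm)).comp (comulOp k (evenPart k A))

theorem adjoint_apply (a : evenPart k A) (v : A) : adjoint k A (.op a) v =
    LinearMap.mul' k A (map (antipodeEven k A) (LinearMap.mulLeft k v ∘ₗ evenIncl k A)
      (comul (R := k) a)) := by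
  simp only [adjoint, AlgHom.comp_apply, comulOp_apply]
  generalize comul (R := k) a = x
  induction x with
  | zero => simp
  | add x y hx hy => simp only [map_add, LinearMap.add_apply, hx, hy]
  | tmul b c => rfl

theorem adjoint_mem_oddPrimitives (a : (evenPart k A)ᵐᵒᵖ) {v : A} (hv : v ∈ oddPrimitives k A) :
    adjoint k A a v ∈ oddPrimitives k A := by
  have := adjoint_mem a.unop hv
  rwa [← adjoint_apply] at this

variable (k A) in
/-- The right adjoint action on the odd primitive elements. -/
def oddAction : (evenPart k A)ᵐᵒᵖ →ₐ[k] Module.End k (oddPrimitives k A) :=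
  AlgHom.ofLinearMap
    { toFun := fun a => (adjoint k A a).restrict fun _ hv => adjoint_mem_oddPrimitives a hv
      map_add' := fun a b => by ext v; simp [LinearMap.restrict_apply]
      map_smul' := fun r a => by ext v; simp [LinearMap.restrict_apply] }
    (by ext v; simp [LinearMap.restrict_apply])
    (fun a b => by ext v; simp [LinearMap.restrict_apply])

theorem coe_oddAction (a : (evenPart k A)ᵐᵒᵖ) (v : oddPrimitives k A) :
    (oddAction k A a v : A) = adjoint k A a v := rfl

/-- A morphism of Hopf superalgebras: a parity-preserving algebra and coalgebra map. -/
structure Hom (k : Type v) (B A : Type u) [Field k] [Ring B] [Algebra k B] [HopfSuperalgebra k B]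
    [Ring A] [Algebra k A] [HopfSuperalgebra k A] extends B →ₐc[k] A where
  map_parity (i : ZMod 2) (b : B) (hb : b ∈ parity (k := k) (A := B) i) :
    toFun b ∈ parity (k := k) (A := A) i

variable {B : Type u} [Ring B] [Algebra k B] [HopfSuperalgebra k B]

namespace Hom

variable (ι : Hom k B A)

/-- The underlying algebra map. -/
def algHom : B →ₐ[k] A := (ι.toBialgHom : B →ₐ[k] A)

theorem map_comul (b : B) : map ι.algHom.toLinearMap ι.algHom.toLinearMap (comul (R := k) b) =
    comul (ι.algHom b) :=
  LinearMap.congr_fun ι.map_comp_comul b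

theorem map_counit (b : B) : counit (R := k) (ι.algHom b) = counit (R := k) b :=
  LinearMap.congr_fun ι.counit_comp b

theorem map_mem_evenPart {b : B} (hb : b ∈ evenPart k B) : ι.algHom b ∈ evenPart k A := by
  rw [mem_evenPart, ← map_comul]
  refine evenTensor_induction (mem_evenPart.1 hb) (by simp) (fun x y hx hy => ?_) ?_
  · rw [map_add]; exact add_mem hx hy
  · intro a c ha hc
    exact tmul_mem_evenTensor (ι.map_parity 0 a ha) (ι.map_parity 0 c hc)

/-- The map of ordinary Hopf algebras induced on the largest purely even parts. -/
def evenAlgHom : evenPart k B →ₐ[k] evenPart k A :=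
  (ι.algHom.comp (evenPart k B).val).codRestrict (evenPart k A) fun b => ι.map_mem_evenPart b.2

/-- The bialgebra map induced on the largest purely even parts. -/
def evenMap : evenPart k B →ₐc[k] evenPart k A :=
  BialgHom.ofAlgHom ι.evenAlgHom
    (by ext b; exact ι.map_counit b)
    (by
      ext b
      apply map_evenIncl_injective
      refine Eq.trans ?_ ((ι.map_comul b).trans (map_evenIncl_comul (ι.evenAlgHom b)).symm)
      rw [← map_evenIncl_comul]
      change map (evenIncl k A) (evenIncl k A)
        (map ι.evenAlgHom.toLinearMap ι.evenAlgHom.toLinearMap (comul (R := k) b)) = _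
      generalize comul (R := k) b = x
      induction x with
      | zero => simp
      | add x y hx hy => simp only [map_add, hx, hy]
      | tmul a c => rfl)

theorem coe_evenMap (b : evenPart k B) : (ι.evenMap b : A) = ι.algHom b := rfl

/-- The map induced on the odd primitive elements. -/
def oddMap : oddPrimitives k B →ₗ[k] oddPrimitives k A :=
  ι.algHom.toLinearMap.restrict fun v hv => by
    refine ⟨ι.map_parity 1 v hv.1, ?_⟩
    change comul (ι.algHom v) = 1 ⊗ₜ ι.algHom v + ι.algHom v ⊗ₜ 1
    rw [← map_comul, hv.2]
    simp

theorem coe_oddMap (v : oddPrimitives k B) : (ι.oddMap v : A) = ι.algHom v := rfl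

theorem map_antipode (b : B) : ι.algHom (antipode (k := k) b) = antipode (k := k) (ι.algHom b) := by
  have h1 : toConv (ι.algHom.toLinearMap ∘ₗ antipode (k := k)) * toConv ι.algHom.toLinearMap = 1 := by
    have h := LinearMap.algHom_comp_convMul_distrib ι.algHom
      (toConv (antipode (k := k) (A := B))) (toConv LinearMap.id)
    rw [antipode_conv_id] at h
    apply WithConv.ext
    refine h.symm.trans ?_
    ext b
    exact ι.algHom.commutes _
  have h2 : toConv ι.algHom.toLinearMap * toConv (antipode (k := k) ∘ₗ ι.algHom.toLinearMap) = 1 := by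
    have h := LinearMap.convMul_comp_coalgHom_distrib
      (toConv LinearMap.id) (toConv (antipode (k := k) (A := A))) ι.toCoalgHom
    rw [id_conv_antipode] at h
    apply WithConv.ext
    refine h.symm.trans ?_
    ext b
    exact congrArg (algebraMap k A) (ι.map_counit b)
  exact congrArg (fun f => f b) (left_inv_eq_right_inv h1 h2)

theorem map_adjoint (c : (evenPart k B)ᵐᵒᵖ) (v : B) :
    ι.algHom (adjoint k B c v) = restrictAction ι.evenMap (adjoint k A) c (ι.algHom v) := by
  have e : restrictAction ι.evenMap (adjoint k A) c (ι.algHom v) =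
      adjoint k A (.op (ι.evenMap c.unop)) (ι.algHom v) := rfl
  have h : comul (R := k) (ι.evenMap c.unop) =
      map ι.evenAlgHom.toLinearMap ι.evenAlgHom.toLinearMap (comul (R := k) c.unop) :=
    (LinearMap.congr_fun ι.evenMap.map_comp_comul c.unop).symm
  rw [e, ← MulOpposite.op_unop c, adjoint_apply, adjoint_apply, MulOpposite.unop_op, h]
  generalize comul (R := k) c.unop = x
  induction x with
  | zero => simp
  | add x y hx hy => simp only [map_add, hx, hy]
  | tmul a b =>
    change ι.algHom (antipode (k := k) (a : B) * (v * (b : B))) =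
      antipode (k := k) (ι.algHom a) * (ι.algHom v * ι.algHom b)
    rw [map_mul, map_mul, map_antipode]

/-- `V_B → V_A` is linear over the even part of `B`. -/
theorem oddMap_oddAction (c : (evenPart k B)ᵐᵒᵖ) (v : oddPrimitives k B) :
    ι.oddMap (oddAction k B c v) = restrictAction ι.evenMap (oddAction k A) c (ι.oddMap v) :=
  Subtype.ext (ι.map_adjoint c v)

end Hom

end HopfSuperalgebra

/-! ### Right comodules in the category of right modules -/

open TensorProduct Coalgebra CategoryTheory

section ModComod

variable {k : Type v} [Field k] {K J : Type u} [Ring K] [Bialgebra k K] [Ring J] [Bialgebra k J]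

/-- The objects of `Mod_K^J`: right `J`-comodules in the monoidal category of right `K`-modules,
where `J` is a right `K`-module through a bialgebra map `φ : K → J`. -/
structure ModComod (φ : K →ₐc[k] J) where
  carrier : Type u
  [addCommGroup : AddCommGroup carrier]
  [module : Module k carrier]
  act : Kᵐᵒᵖ →ₐ[k] Module.End k carrier
  coact : carrier →ₗ[k] carrier ⊗[k] J
  coassoc : (TensorProduct.assoc k carrier J J).toLinearMap ∘ₗ coact.rTensor J ∘ₗ coact =
    comul.lTensor carrier ∘ₗ coact
  counit_coact : counit.lTensor carrier ∘ₗ coact = (TensorProduct.mk k carrier k).flip 1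
  /-- The coaction is `K`-linear. -/
  coact_act (c : Kᵐᵒᵖ) : coact ∘ₗ act c = diagonalAction act (regularAction φ) c ∘ₗ coact

namespace ModComod

attribute [instance] addCommGroup module

variable {φ : K →ₐc[k] J}

/-- The `K`-linear and `J`-colinear maps. -/
def homs (M N : ModComod φ) : Submodule k (M.carrier →ₗ[k] N.carrier) where
  carrier := {f | (∀ c, f ∘ₗ M.act c = N.act c ∘ₗ f) ∧ N.coact ∘ₗ f = f.rTensor J ∘ₗ M.coact}
  add_mem' {f g} hf hg := by
    refine ⟨fun c => ?_, ?_⟩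
    · rw [LinearMap.add_comp, LinearMap.comp_add, hf.1, hg.1]
    · rw [LinearMap.comp_add, LinearMap.rTensor_add, LinearMap.add_comp, hf.2, hg.2]
  zero_mem' := ⟨fun c => by simp, by simp⟩
  smul_mem' r f hf := by
    refine ⟨fun c => ?_, ?_⟩
    · rw [LinearMap.smul_comp, LinearMap.comp_smul, hf.1]
    · rw [LinearMap.comp_smul, LinearMap.rTensor_smul, LinearMap.smul_comp, hf.2]

instance instCategory : Category (ModComod φ) where
  Hom M N := homs M N
  id M := ⟨LinearMap.id, fun c => by simp, by simp⟩
  comp f g := ⟨g.1 ∘ₗ f.1,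
    fun c => by rw [LinearMap.comp_assoc, f.2.1, ← LinearMap.comp_assoc, g.2.1,
      LinearMap.comp_assoc],
    by rw [← LinearMap.comp_assoc, g.2.2, LinearMap.comp_assoc, f.2.2, LinearMap.rTensor_comp,
      LinearMap.comp_assoc]⟩

instance instPreadditive : Preadditive (ModComod φ) where
  homGroup M N := inferInstanceAs (AddCommGroup (homs M N))
  add_comp _ _ _ f g h := Subtype.ext (LinearMap.comp_add f.1 g.1 h.1)
  comp_add _ _ _ f g h := Subtype.ext (LinearMap.add_comp f.1 h.1 g.1)

/-- The underlying linear map of a morphism. -/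
def linearMap {M N : ModComod φ} (f : M ⟶ N) : M.carrier →ₗ[k] N.carrier := f.1

/-- A linear map is `J`-colinear. -/
def IsColinear {M N : ModComod φ} (f : M.carrier →ₗ[k] N.carrier) : Prop :=
  N.coact ∘ₗ f = f.rTensor J ∘ₗ M.coact

theorem rightComm_comul [IsCocomm k K] (c : K) :
    TensorProduct.rightComm k K K K (comul.rTensor K (comul (R := k) c)) =
      comul.rTensor K (comul (R := k) c) := by
  have h1 : comul.rTensor K (comul (R := k) c) =
      (TensorProduct.assoc k K K K).symm (comul.lTensor K (comul c)) := by
    rw [← Coalgebra.coassoc_apply]; simp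
  have h2 : ∀ x : K ⊗[k] K, TensorProduct.rightComm k K K K
      ((TensorProduct.assoc k K K K).symm (comul.lTensor K x)) =
      (TensorProduct.assoc k K K K).symm
        (((TensorProduct.comm k K K).toLinearMap ∘ₗ comul).lTensor K x) := by
    intro x
    induction x with
    | zero => simp
    | add x y hx hy => simp only [map_add, hx, hy]
    | tmul a b =>
      simp only [LinearMap.lTensor_tmul, LinearMap.comp_apply]
      generalize comul (R := k) b = y
      induction y with
      | zero => simp
      | add x y hx hy => simp only [tmul_add, map_add, hx, hy]
      | tmul d e => rfl
  rw [h1, h2, IsCocomm.comm_comp_comul]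

/-- `J ⊗ W` for a right `K`-module `W`: `K` acts diagonally, and `J` coacts on the factor `J`,
`a ⊗ w ↦ (a₁ ⊗ w) ⊗ a₂`. -/
def cofree [IsCocomm k K] (φ : K →ₐc[k] J) (W : Type u) [AddCommGroup W] [Module k W]
    (ρ : Kᵐᵒᵖ →ₐ[k] Module.End k W) : ModComod φ where
  carrier := J ⊗[k] W
  act := diagonalAction (regularAction φ) ρ
  coact := (TensorProduct.rightComm k J J W).toLinearMap ∘ₗ comul.rTensor W
  coassoc := by
    ext a w
    have h1 : ∀ y : J ⊗[k] J, TensorProduct.assoc k (J ⊗[k] W) J J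
        (((TensorProduct.rightComm k J J W).toLinearMap ∘ₗ comul.rTensor W).rTensor J
          (TensorProduct.rightComm k J J W (y ⊗ₜ w))) =
        ((TensorProduct.mk k J W).flip w).rTensor (J ⊗[k] J)
          (TensorProduct.assoc k J J J (comul.rTensor J y)) := by
      intro y
      induction y with
      | zero => simp
      | add x y hx hy => simp only [add_tmul, map_add, hx, hy]
      | tmul b c =>
        simp only [rightComm_tmul, LinearMap.rTensor_tmul, LinearMap.comp_apply,
          LinearEquiv.coe_coe]
        generalize comul (R := k) b = z
        induction z with
        | zero => simp
        | add x y hx hy => simp only [add_tmul, map_add, hx, hy]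
        | tmul d e => rfl
    have h2 : ∀ y : J ⊗[k] J, comul.lTensor (J ⊗[k] W)
        (TensorProduct.rightComm k J J W (y ⊗ₜ w)) =
        ((TensorProduct.mk k J W).flip w).rTensor (J ⊗[k] J) (comul.lTensor J y) := by
      intro y
      induction y with
      | zero => simp
      | add x y hx hy => simp only [add_tmul, map_add, hx, hy]
      | tmul b c => rfl
    refine (h1 (comul a)).trans ?_
    rw [Coalgebra.coassoc_apply]
    exact (h2 (comul a)).symm
  counit_coact := by
    ext a w
    have h2 : ∀ y : J ⊗[k] J, counit.lTensor (J ⊗[k] W)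
        (TensorProduct.rightComm k J J W (y ⊗ₜ w)) =
        ((TensorProduct.mk k J W).flip w).rTensor k (counit.lTensor J y) := by
      intro y
      induction y with
      | zero => simp
      | add x y hx hy => simp only [add_tmul, map_add, hx, hy]
      | tmul b c => rfl
    refine (h2 (comul a)).trans ?_
    rw [Coalgebra.lTensor_counit_comul]
    rfl
  coact_act c := by
    obtain ⟨c, rfl⟩ := MulOpposite.op_surjective c
    ext a w
    have h1 : ∀ x : K ⊗[k] K, TensorProduct.rightComm k J J W
        (comul.rTensor W (map (orbitMap (regularAction φ) a) (orbitMap ρ w) x)) =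
        TensorProduct.rightComm k J J W
          (map (LinearMap.mulLeft k (comul (R := k) a) ∘ₗ
            map (φ : K →ₗ[k] J) (φ : K →ₗ[k] J)) (orbitMap ρ w) (comul.rTensor K x)) := by
      intro x
      induction x with
      | zero => simp
      | add x y hx hy => simp only [map_add, hx, hy]
      | tmul b d =>
        have hb : comul (R := k) (a * φ b) =
            comul a * map (φ : K →ₗ[k] J) (φ : K →ₗ[k] J) (comul (R := k) b) := by
          rw [Bialgebra.comul_mul]
          exact congrArg _ (LinearMap.congr_fun φ.map_comp_comul b).symm
        change TensorProduct.rightComm k J J W (comul (a * φ b) ⊗ₜ orbitMap ρ w d) = _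
        rw [hb]
        rfl
    have h2 : ∀ (b d : J) (z : (K ⊗[k] K) ⊗[k] K),
        map (map (orbitMap (regularAction φ) b) (orbitMap ρ w)) (orbitMap (regularAction φ) d)
          (TensorProduct.rightComm k K K K z) =
        TensorProduct.rightComm k J J W (map (LinearMap.mulLeft k (b ⊗ₜ[k] d) ∘ₗ
            map (φ : K →ₗ[k] J) (φ : K →ₗ[k] J)) (orbitMap ρ w) z) := by
      intro b d z
      induction z with
      | zero => simp
      | add x y hx hy => simp only [map_add, hx, hy]
      | tmul z g =>
        induction z with
        | zero => simp
        | add x y hx hy => simp only [add_tmul, map_add, hx, hy]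
        | tmul e f =>
          simp only [rightComm_tmul, map_tmul, LinearMap.comp_apply, LinearMap.mulLeft_apply,
            Algebra.TensorProduct.tmul_mul_tmul]
          rfl
    have h3 : ∀ y : J ⊗[k] J,
        diagonalAction (diagonalAction (regularAction φ) ρ) (regularAction φ) (.op c)
          (TensorProduct.rightComm k J J W (y ⊗ₜ w)) =
        TensorProduct.rightComm k J J W
          (map (LinearMap.mulLeft k y ∘ₗ
            map (φ : K →ₗ[k] J) (φ : K →ₗ[k] J)) (orbitMap ρ w)
              (comul.rTensor K (comul (R := k) c))) := by
      intro y
      induction y with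
      | zero => simp
      | add x y hx hy =>
        have e : LinearMap.mulLeft k (x + y) = LinearMap.mulLeft k x + LinearMap.mulLeft k y := by
          ext; simp [add_mul]
        simp only [add_tmul, map_add, hx, hy, e, LinearMap.add_comp, map_add_left,
          LinearMap.add_apply]
      | tmul b d =>
        rw [← h2, rightComm_comul, rightComm_tmul, diagonalAction_tmul]
        have e : orbitMap (diagonalAction (regularAction φ) ρ) (b ⊗ₜ[k] w) =
            map (orbitMap (regularAction φ) b) (orbitMap ρ w) ∘ₗ comul :=
          LinearMap.ext fun c => diagonalAction_tmul _ _ c b w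
        rw [e]
        generalize comul (R := k) c = x
        induction x with
        | zero => simp
        | add x y hx hy => simp only [map_add, hx, hy]
        | tmul e f => rfl
    refine Eq.trans ?_ (h3 (comul a)).symm
    rw [← h1, ← diagonalAction_tmul]
    rfl

/-- The morphism `id ⊗ f : J ⊗ W → J ⊗ W'` for a `K`-linear map `f : W → W'`. -/
def cofreeMap [IsCocomm k K] {W W' : Type u} [AddCommGroup W] [Module k W] [AddCommGroup W']
    [Module k W'] {ρ : Kᵐᵒᵖ →ₐ[k] Module.End k W} {ρ' : Kᵐᵒᵖ →ₐ[k] Module.End k W'}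
    (f : W →ₗ[k] W') (hf : ∀ c w, f (ρ c w) = ρ' c (f w)) : cofree φ W ρ ⟶ cofree φ W' ρ' :=
  ⟨f.lTensor J, fun c => by
      obtain ⟨c, rfl⟩ := MulOpposite.op_surjective c
      refine TensorProduct.ext' fun a w => ?_
      change f.lTensor J (diagonalAction (regularAction φ) ρ (.op c) (a ⊗ₜ w)) =
        diagonalAction (regularAction φ) ρ' (.op c) (a ⊗ₜ f w)
      rw [diagonalAction_tmul, diagonalAction_tmul]
      generalize comul (R := k) c = x
      induction x with
      | zero => simp
      | add x y hx hy => simp only [map_add, hx, hy]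
      | tmul d e => exact congrArg (_ ⊗ₜ ·) (hf (.op e) w), by
      refine TensorProduct.ext' fun a w => ?_
      change TensorProduct.rightComm k J J W' (comul a ⊗ₜ f w) =
        (f.lTensor J).rTensor J (TensorProduct.rightComm k J J W (comul a ⊗ₜ w))
      generalize comul (R := k) a = x
      induction x with
      | zero => simp
      | add x y hx hy => simp only [add_tmul, map_add, hx, hy]
      | tmul d e => rfl⟩

end ModComod

end ModComod

namespace HopfSuperalgebra.Hom

variable {k : Type v} [Field k] {B A : Type u} [Ring B] [Algebra k B] [HopfSuperalgebra k B]
  [Ring A] [Algebra k A] [HopfSuperalgebra k A] (ι : Hom k B A)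

/-- The quotient `Q = V_A / V_B` of the spaces of odd primitive elements. -/
abbrev OddQuotient : Type u := oddPrimitives k A ⧸ LinearMap.range ι.oddMap

/-- The right `K`-module structure of `V_A / V_B`, where `K` is the even part of `B`. -/
def oddQuotientAction : (evenPart k B)ᵐᵒᵖ →ₐ[k] Module.End k ι.OddQuotient :=
  quotientAction (restrictAction ι.evenMap (oddAction k A)) (LinearMap.range ι.oddMap) <| by
    rintro c _ ⟨v, rfl⟩
    exact ⟨oddAction k B c v, ι.oddMap_oddAction c v⟩

/-- The sequence `J ⊗ V_B → J ⊗ V_A → J ⊗ Q` in `Mod_K^J`, where `K` and `J` are the largest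
purely even Hopf sub-superalgebras of `B` and `A`. -/
def oddSequence : ShortComplex (ModComod ι.evenMap) where
  X₁ := .cofree ι.evenMap (oddPrimitives k B) (oddAction k B)
  X₂ := .cofree ι.evenMap (oddPrimitives k A) (restrictAction ι.evenMap (oddAction k A))
  X₃ := .cofree ι.evenMap ι.OddQuotient ι.oddQuotientAction
  f := ModComod.cofreeMap ι.oddMap ι.oddMap_oddAction
  g := ModComod.cofreeMap (LinearMap.range ι.oddMap).mkQ fun _ _ => rfl
  zero := Subtype.ext <| TensorProduct.ext' fun a v => by
    change a ⊗ₜ[k] (LinearMap.range ι.oddMap).mkQ (ι.oddMap v) = 0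
    have h : (LinearMap.range ι.oddMap).mkQ (ι.oddMap v) = 0 :=
      (Submodule.Quotient.mk_eq_zero _).2 (LinearMap.mem_range_self _ v)
    rw [h, tmul_zero]

end HopfSuperalgebra.Hom

end

/-!
Write `K` and `J` for the even parts of `𝕂` and `𝕁`. They are cocommutative Hopf algebras, and the
map `K → J` is injective. The theorem is of Maschke type, and everything rests on the existence of
a *cointegral*: a right `K`-linear map `ψ : J → K` which preserves the counit
(`exists_cointegral`).

Given `ψ` and a `J`-colinear section `s` of a morphism `p : M → N` of `Mod_K^J`, put
`t(n) = s(n₀ S(ψ(n₁)₁)) ψ(n₁)₂`. The antipode axiom makes `t` linear over `K`, cocommutativity of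
`K` and `J` makes it colinear, and the counit condition on `ψ` makes it a section of `p`
(`ModComod.exists_section`). For the sequence `J ⊗ V_𝕂 → J ⊗ V_𝕁 → J ⊗ Q`, a linear section of
`V_𝕁 → Q` tensored with `J` is a colinear section, and exactness then yields the retraction
(`ModComod.nonempty_splitting`).

To find `ψ` one may pass to the algebraic closure of `k`, because a linear retraction of the field
extension carries a cointegral back. Over an algebraically closed field, the dual algebra of the
cocommutative coalgebra `J` acts on any comodule by commuting, locally finite operators; a common
eigenvector shows that each nonzero comodule contains a nonzero vector `m` with coaction `m ⊗ g`,
where `g` is grouplike (`exists_coact_eq_tmul_isGroupLikeElem`). If the comodule is also a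
compatible `K`-module, then `m K` is free on `m` (`orbitMap_injective_of_coact_eq`). Hence a
cointegral defined on a proper subobject `D` of `J` extends: a grouplike vector of `J / D` is the
class of some `x`, the sum `D + x K` is direct with `x K` free, and `x` may be sent to `ε(x)`.
Zorn's lemma concludes.
-/

noncomputable section

open TensorProduct Coalgebra CategoryTheory

/-! ### Grouplike vectors in comodules -/

section GrouplikeVectors

/-- A commuting family of operators on a nonzero finite-dimensional vector space over an
algebraically closed field has a common eigenvector. -/
theorem Module.End.exists_common_eigenvector {F : Type*} [Field F] [IsAlgClosed F] {ι : Type*}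
    (n : ℕ) : ∀ {V : Type*} [AddCommGroup V] [Module F V] [FiniteDimensional F V] [Nontrivial V]
      (T : ι → Module.End F V), (∀ i j, Commute (T i) (T j)) → Module.finrank F V ≤ n →
      ∃ v : V, v ≠ 0 ∧ ∃ χ : ι → F, ∀ i, T i v = χ i • v := by
  induction n with
  | zero =>
    intro V _ _ _ _ T _ hn
    exact absurd hn (not_le.2 Module.finrank_pos)
  | succ n ih =>
    intro V _ _ _ _ T hT hn
    by_cases hs : ∀ i, ∃ c : F, T i = c • LinearMap.id
    · obtain ⟨v, hv⟩ := exists_ne (0 : V)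
      choose χ hχ using hs
      exact ⟨v, hv, χ, fun i => by rw [hχ]; rfl⟩
    · push Not at hs
      obtain ⟨i, hi⟩ := hs
      obtain ⟨c, hc⟩ := Module.End.exists_eigenvalue (T i)
      set E := Module.End.eigenspace (T i) c with hE
      have hmaps : ∀ j, ∀ v ∈ E, T j v ∈ E := by
        intro j v hv
        rw [hE, Module.End.mem_eigenspace_iff] at hv ⊢
        rw [← Module.End.mul_apply, (hT i j).eq, Module.End.mul_apply, hv, map_smul]
      have hlt : E < ⊤ := by
        refine lt_top_iff_ne_top.2 fun h => hi c (LinearMap.ext fun v => ?_)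
        exact Module.End.mem_eigenspace_iff.1 (h ▸ Submodule.mem_top : v ∈ E)
      have : Nontrivial E := Submodule.nontrivial_iff_ne_bot.2 hc
      obtain ⟨v, hv, χ, hχ⟩ := ih (fun j => (T j).restrict (hmaps j))
        (fun j l => LinearMap.ext fun v => Subtype.ext <| by
          exact LinearMap.congr_fun (hT j l) (v : V))
        (Nat.lt_succ_iff.1 ((Submodule.finrank_lt hlt.ne).trans_le hn))
      exact ⟨v, fun h => hv (Subtype.ext h), χ, fun j => congrArg Subtype.val (hχ j)⟩

variable {F : Type*} [Field F] {M J : Type*} [AddCommGroup M] [Module F M]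
  [AddCommGroup J] [Module F J]

/-- The slice `m ⊗ j ↦ f(j) m`. -/
def sliceRight (f : Module.Dual F J) : M ⊗[F] J →ₗ[F] M :=
  (TensorProduct.rid F M).toLinearMap ∘ₗ f.lTensor M

@[simp]
theorem sliceRight_tmul (f : Module.Dual F J) (m : M) (j : J) :
    sliceRight f (m ⊗ₜ[F] j) = f j • m := by
  simp [sliceRight]

open Classical in
theorem sliceRight_ext {x y : M ⊗[F] J} (h : ∀ f, sliceRight f x = sliceRight f y) : x = y := by
  let b := Module.Basis.ofVectorSpace F J
  apply (TensorProduct.equivFinsuppOfBasisRight (M := M) b).injective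
  have key : ∀ (z : M ⊗[F] J) i,
      TensorProduct.equivFinsuppOfBasisRight b z i = sliceRight (b.coord i) z := by
    intro z i
    induction z with
    | zero => simp
    | add z w hz hw => simp only [map_add, Finsupp.add_apply, hz, hw]
    | tmul m j => simp
  ext i
  rw [key, key, h]

/-- All slices of a given tensor lie in a common finite-dimensional subspace. -/
theorem exists_finiteDimensional_sliceRight_mem (x : M ⊗[F] J) :
    ∃ W : Submodule F M, FiniteDimensional F W ∧ ∀ f, sliceRight f x ∈ W := by
  induction x with
  | zero => exact ⟨⊥, inferInstance, fun f => by simp⟩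
  | add x y hx hy =>
    obtain ⟨W, _, hW⟩ := hx
    obtain ⟨W', _, hW'⟩ := hy
    refine ⟨W ⊔ W', inferInstance, fun f => ?_⟩
    rw [map_add]
    exact add_mem (Submodule.mem_sup_left (hW f)) (Submodule.mem_sup_right (hW' f))
  | tmul m j =>
    refine ⟨F ∙ m, inferInstance, fun f => ?_⟩
    rw [sliceRight_tmul]
    exact Submodule.smul_mem _ _ (Submodule.mem_span_singleton_self m)

variable [Coalgebra F J]

/-- The operators `m ↦ f(m₁) m₀` compose by the convolution product of the dual of `J`. -/
theorem sliceRight_coact_sliceRight_coact (δ : M →ₗ[F] M ⊗[F] J)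
    (hassoc : (TensorProduct.assoc F M J J).toLinearMap ∘ₗ δ.rTensor J ∘ₗ δ =
      comul.lTensor M ∘ₗ δ) (f g : Module.Dual F J) (m : M) :
    sliceRight f (δ (sliceRight g (δ m))) =
      sliceRight (LinearMap.mul' F F ∘ₗ map f g ∘ₗ comul) (δ m) := by
  have h1 : ∀ x : M ⊗[F] J, sliceRight f (δ (sliceRight g x)) =
      sliceRight (LinearMap.mul' F F ∘ₗ map f g)
        (TensorProduct.assoc F M J J (δ.rTensor J x)) := by
    intro x
    induction x with
    | zero => simp
    | add x y hx hy => simp only [map_add, hx, hy]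
    | tmul m j =>
      rw [sliceRight_tmul, map_smul, map_smul, LinearMap.rTensor_tmul]
      generalize δ m = y
      induction y with
      | zero => simp
      | add x y hx hy => simp only [map_add, add_tmul, smul_add, hx, hy]
      | tmul n i => simp [mul_smul, smul_comm (f i)]
  have h2 : ∀ x : M ⊗[F] J, sliceRight (LinearMap.mul' F F ∘ₗ map f g) (comul.lTensor M x) =
      sliceRight (LinearMap.mul' F F ∘ₗ map f g ∘ₗ comul) x := by
    intro x
    induction x with
    | zero => simp
    | add x y hx hy => simp only [map_add, hx, hy]
    | tmul m j => simp
  rw [h1, ← h2]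
  exact congrArg _ (LinearMap.congr_fun hassoc m)

/-- The dual algebra of a cocommutative coalgebra acts on each comodule by commuting, locally
finite operators; over an algebraically closed field a common eigenvector of these on a cyclic
submodule spans a one-dimensional subcomodule, whose coefficient is grouplike. -/
theorem exists_coact_eq_tmul_isGroupLikeElem [IsAlgClosed F] [IsCocomm F J] [Nontrivial M]
    (δ : M →ₗ[F] M ⊗[F] J)
    (hassoc : (TensorProduct.assoc F M J J).toLinearMap ∘ₗ δ.rTensor J ∘ₗ δ =
      comul.lTensor M ∘ₗ δ)
    (hcounit : counit.lTensor M ∘ₗ δ = (TensorProduct.mk F M F).flip 1) :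
    ∃ (m : M) (g : J), m ≠ 0 ∧ IsGroupLikeElem F g ∧ δ m = m ⊗ₜ g := by
  have hcomm : ∀ (f g : Module.Dual F J) m, sliceRight f (δ (sliceRight g (δ m))) =
      sliceRight g (δ (sliceRight f (δ m))) := by
    intro f g m
    rw [sliceRight_coact_sliceRight_coact δ hassoc, sliceRight_coact_sliceRight_coact δ hassoc]
    refine LinearMap.congr_fun (congrArg (sliceRight (M := M)) (LinearMap.ext fun j => ?_)) _
    have h : ∀ x : J ⊗[F] J, LinearMap.mul' F F (map f g (TensorProduct.comm F J J x)) =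
        LinearMap.mul' F F (map g f x) := by
      intro x
      induction x with
      | zero => simp
      | add x y hx hy => simp only [map_add, hx, hy]
      | tmul a b => simp [mul_comm]
    rw [LinearMap.comp_apply, LinearMap.comp_apply, LinearMap.comp_apply, LinearMap.comp_apply,
      ← h, Coalgebra.comm_comul]
  have hcu : ∀ m, sliceRight counit (δ m) = m := fun m => by
    have h := LinearMap.congr_fun hcounit m
    simp only [LinearMap.comp_apply] at h
    rw [sliceRight, LinearMap.comp_apply, h]
    simp
  obtain ⟨m₀, hm₀⟩ := exists_ne (0 : M)
  obtain ⟨W₀, _, hW₀⟩ := exists_finiteDimensional_sliceRight_mem (δ m₀)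
  -- the cyclic submodule generated by `m₀` under the dual algebra
  let W : Submodule F M :=
    { carrier := {m | ∃ f : Module.Dual F J, sliceRight f (δ m₀) = m}
      add_mem' := by
        rintro _ _ ⟨f, rfl⟩ ⟨g, rfl⟩
        exact ⟨f + g, by simp [sliceRight, LinearMap.lTensor_add]⟩
      zero_mem' := ⟨0, by simp [sliceRight]⟩
      smul_mem' := by
        rintro c _ ⟨f, rfl⟩
        exact ⟨c • f, by simp [sliceRight, LinearMap.lTensor_smul]⟩ }
  have hWle : W ≤ W₀ := by
    rintro _ ⟨f, rfl⟩
    exact hW₀ f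
  have : FiniteDimensional F W := Submodule.finiteDimensional_of_le hWle
  have : Nontrivial W := ⟨⟨⟨m₀, counit, hcu m₀⟩, 0, fun h => hm₀ (congrArg Subtype.val h)⟩⟩
  have hmaps : ∀ f : Module.Dual F J, ∀ m ∈ W, (sliceRight f ∘ₗ δ) m ∈ W := by
    rintro f _ ⟨g, rfl⟩
    exact ⟨_, (sliceRight_coact_sliceRight_coact δ hassoc f g m₀).symm⟩
  obtain ⟨⟨m, hmW⟩, hm, χ, hχ⟩ := Module.End.exists_common_eigenvector _
    (fun f : Module.Dual F J => (sliceRight f ∘ₗ δ).restrict (hmaps f))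
    (fun f g => LinearMap.ext fun m => Subtype.ext (hcomm f g m)) le_rfl
  have hm0 : m ≠ 0 := fun h => hm (Subtype.ext h)
  have hχ' : ∀ f, sliceRight f (δ m) = χ f • m := fun f => congrArg Subtype.val (hχ f)
  obtain ⟨l, hl⟩ := Module.Projective.exists_dual_eq_one F hm0
  -- the coefficient of the coaction on the line spanned by `m`
  set g := TensorProduct.lid F J (l.rTensor J (δ m)) with hg
  have hfg : ∀ f : Module.Dual F J, f g = χ f := by
    intro f
    have h : ∀ x : M ⊗[F] J, f (TensorProduct.lid F J (l.rTensor J x)) = l (sliceRight f x) := by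
      intro x
      induction x with
      | zero => simp
      | add x y hx hy => simp only [map_add, hx, hy]
      | tmul n j => simp [mul_comm]
    rw [hg, h, hχ', map_smul, hl, smul_eq_mul, mul_one]
  have hδ : δ m = m ⊗ₜ g := sliceRight_ext fun f => by rw [hχ', sliceRight_tmul, hfg]
  refine ⟨m, g, hm0, ⟨?_, ?_⟩, hδ⟩
  · have h := congrArg l (hcu m)
    rwa [hδ, sliceRight_tmul, map_smul, hl, smul_eq_mul, mul_one] at h
  · have h := LinearMap.congr_fun hassoc m
    simp only [LinearMap.comp_apply, hδ, LinearMap.rTensor_tmul, LinearMap.lTensor_tmul,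
      LinearEquiv.coe_coe, TensorProduct.assoc_tmul] at h
    simpa [hl] using (congrArg (TensorProduct.lid F _ ∘ l.rTensor (J ⊗[F] J)) h).symm

end GrouplikeVectors

/-! ### Cointegrals for Hopf subalgebras -/

section Cointegral

theorem orbitMap_add {k : Type v} {K M : Type u} [Field k] [Ring K] [Bialgebra k K]
    [AddCommGroup M] [Module k M] (ρ : Kᵐᵒᵖ →ₐ[k] Module.End k M) (m n : M) :
    orbitMap ρ (m + n) = orbitMap ρ m + orbitMap ρ n := by
  ext; simp [orbitMap]

theorem orbitMap_smul {k : Type v} {K M : Type u} [Field k] [Ring K] [Bialgebra k K]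
    [AddCommGroup M] [Module k M] (ρ : Kᵐᵒᵖ →ₐ[k] Module.End k M) (r : k) (m : M) :
    orbitMap ρ (r • m) = r • orbitMap ρ m := by
  ext; simp [orbitMap]

/-- In Sweedler notation, `c₁ S(c₂) ⊗ c₃ = 1 ⊗ c`. -/
theorem rTensor_mul_antipode_comul {k : Type v} {K : Type u} [Field k] [Ring K] [HopfAlgebra k K]
    (c : K) :
    (LinearMap.mul' k K ∘ₗ (HopfAlgebra.antipode k).lTensor K).rTensor K
      ((TensorProduct.assoc k K K K).symm (comul.lTensor K (comul (R := k) c))) = 1 ⊗ₜ c := by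
  have h : (LinearMap.mul' k K ∘ₗ (HopfAlgebra.antipode k).lTensor K) ∘ₗ comul =
      Algebra.linearMap k K ∘ₗ counit := HopfAlgebra.mul_antipode_lTensor_comul
  rw [← Coalgebra.coassoc_apply, LinearEquiv.symm_apply_apply, ← LinearMap.comp_apply,
    ← LinearMap.rTensor_comp, h, LinearMap.rTensor_comp, LinearMap.comp_apply,
    Coalgebra.rTensor_counit_comul]
  simp

variable {k : Type v} [Field k] {K J : Type u} [Ring K] [HopfAlgebra k K] [Ring J]
  [HopfAlgebra k J]

/-- A nonzero vector of a Hopf module on which the coaction is grouplike generates a free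
submodule: from `m c₁ ⊗ g c₂` one recovers `m c₁ S(c₂) ⊗ c₃ = m ⊗ c`. -/
theorem orbitMap_injective_of_coact_eq {M : Type u} [AddCommGroup M] [Module k M]
    (φ : K →ₐc[k] J) (hφ : Function.Injective φ) (ρ : Kᵐᵒᵖ →ₐ[k] Module.End k M)
    (δ : M →ₗ[k] M ⊗[k] J) {m : M} (hm : m ≠ 0) {g : J} (hg : IsGroupLikeElem k g)
    (hδ : ∀ c, δ (orbitMap ρ m c) =
      map (orbitMap ρ m) (LinearMap.mulLeft k g ∘ₗ (φ : K →ₗ[k] J)) (comul (R := k) c)) :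
    Function.Injective (orbitMap ρ m) := by
  rw [← LinearMap.ker_eq_bot, LinearMap.ker_eq_bot']
  intro c hc
  have hinj : Function.Injective (LinearMap.mulLeft k g ∘ₗ (φ : K →ₗ[k] J)) := by
    intro a b hab
    exact hφ (hg.isUnit.mul_left_cancel hab)
  have h0 : map (orbitMap ρ m) LinearMap.id (comul (R := k) c) = 0 := by
    apply Module.Flat.lTensor_preserves_injective_linearMap (M := M) _ hinj
    rw [LinearMap.lTensor, ← LinearMap.comp_apply, ← map_comp, map_zero]
    simpa [hc] using (hδ c).symm
  -- the lifted map is `n ⊗ c ↦ n S(c₁) ⊗ c₂`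
  have h1 : ∀ x : K ⊗[k] K,
      map (orbitMap ρ m) LinearMap.id
        ((LinearMap.mul' k K ∘ₗ (HopfAlgebra.antipode k).lTensor K).rTensor K
          ((TensorProduct.assoc k K K K).symm (comul.lTensor K x))) =
      TensorProduct.lift (LinearMap.mk₂ k
          (fun (n : M) (c : K) => map (orbitMap ρ n ∘ₗ HopfAlgebra.antipode k) LinearMap.id
            (comul (R := k) c))
          (fun n n' c => by simp [orbitMap_add, LinearMap.add_comp, map_add_left])
          (fun r n c => by simp [orbitMap_smul, LinearMap.smul_comp, map_smul_left])
          (fun n c c' => by simp) (fun r n c => by simp)) (map (orbitMap ρ m) LinearMap.id x) := by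
    intro x
    induction x with
    | zero => simp
    | add x y hx hy => simp only [map_add, hx, hy]
    | tmul a b =>
      simp only [LinearMap.lTensor_tmul, map_tmul, lift.tmul, LinearMap.mk₂_apply,
        LinearMap.id_apply]
      generalize comul (R := k) b = y
      induction y with
      | zero => simp
      | add x y hx hy => simp only [map_add, tmul_add, hx, hy]
      | tmul d e => simp [orbitMap]
  have h2 := h1 (comul c)
  rw [h0, map_zero, rTensor_mul_antipode_comul, map_tmul, LinearMap.id_apply] at h2
  have h3 : orbitMap ρ m 1 = m := by simp [orbitMap]
  rw [h3] at h2
  obtain ⟨l, hl⟩ := Module.Projective.exists_dual_eq_one k hm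
  simpa [hl] using congrArg (TensorProduct.lid k K ∘ l.rTensor K) h2

/-- Partially defined `K`-linear maps `J → K` preserving the counit, whose domain is a
`K`-submodule and a subcomodule of `J`. -/
def partialCointegrals (φ : K →ₐc[k] J) : Set (J →ₗ.[k] K) :=
  {f | (∀ d ∈ f.domain, f.domain.mkQ.rTensor J (comul (R := k) d) = 0) ∧
    (∀ (d : f.domain) (c : K), ∃ h : (d : J) * φ c ∈ f.domain, f ⟨_, h⟩ = f d * c) ∧
    ∀ d : f.domain, counit (R := k) (f d) = counit (R := k) (d : J)}

theorem bot_mem_partialCointegrals (φ : K →ₐc[k] J) : ⊥ ∈ partialCointegrals φ := by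
  have h0 : ∀ d ∈ (⊥ : J →ₗ.[k] K).domain, d = 0 := fun d hd => (Submodule.mem_bot k).1 hd
  refine ⟨fun d hd => by rw [h0 d hd]; simp, fun d c => ?_, fun d => ?_⟩
  · have : (d : J) * φ c = 0 := by rw [h0 d d.2, zero_mul]
    refine ⟨by rw [this]; exact zero_mem _, ?_⟩
    exact (zero_mul c).symm
  · rw [h0 d d.2, map_zero]
    exact map_zero _

theorem mkQ_rTensor_eq_zero_of_le {N : Type*} [AddCommGroup N] [Module k N] {D D' : Submodule k N}
    (h : D ≤ D') {x : N ⊗[k] J} (hx : D.mkQ.rTensor J x = 0) : D'.mkQ.rTensor J x = 0 := by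
  have e : D'.mkQ = Submodule.factor h ∘ₗ D.mkQ := by ext; rfl
  rw [e, LinearMap.rTensor_comp, LinearMap.comp_apply, hx, map_zero]

theorem sSup_mem_partialCointegrals (φ : K →ₐc[k] J) {C : Set (J →ₗ.[k] K)}
    (hC : C ⊆ partialCointegrals φ) (hne : C.Nonempty) (hdir : DirectedOn (· ≤ ·) C) :
    LinearPMap.sSup C hdir ∈ partialCointegrals φ := by
  refine ⟨fun d hd => ?_, ?_, ?_⟩
  · obtain ⟨f, hf, hd⟩ := (LinearPMap.mem_domain_sSup_iff hne hdir).1 hd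
    exact mkQ_rTensor_eq_zero_of_le (LinearPMap.le_sSup hdir hf).1 ((hC hf).1 d hd)
  · rintro ⟨d, hd⟩ c
    obtain ⟨f, hf, hd'⟩ := (LinearPMap.mem_domain_sSup_iff hne hdir).1 hd
    obtain ⟨h, e⟩ := (hC hf).2.1 ⟨d, hd'⟩ c
    refine ⟨(LinearPMap.le_sSup hdir hf).1 h, ?_⟩
    rw [LinearPMap.sSup_apply hdir hf ⟨_, h⟩, e, LinearPMap.sSup_apply hdir hf ⟨d, hd'⟩]
  · rintro ⟨d, hd⟩
    obtain ⟨f, hf, hd'⟩ := (LinearPMap.mem_domain_sSup_iff hne hdir).1 hd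
    rw [LinearPMap.sSup_apply hdir hf ⟨d, hd'⟩]
    exact (hC hf).2.2 ⟨d, hd'⟩

variable [IsAlgClosed k] [IsCocomm k J]

/-- A partial cointegral `f` which is not everywhere defined extends. The comodule `J ⧸ D`, for
`D` the domain of `f`, has a grouplike vector, say the class of `x`; it generates a free
`K`-module, so that `D + x K` is the direct sum of `D` and of a free module on `x`, and one may
prescribe `x ↦ ε(x)`. -/
theorem exists_lt_of_mem_partialCointegrals (φ : K →ₐc[k] J) (hφ : Function.Injective φ)
    {f : J →ₗ.[k] K} (hf : f ∈ partialCointegrals φ) (htop : f.domain ≠ ⊤) :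
    ∃ f' ∈ partialCointegrals φ, f ≤ f' ∧ ¬ f' ≤ f := by
  set D := f.domain
  obtain ⟨hf1, hf2, hf3⟩ := hf
  have hstab : ∀ c, D ≤ D.comap (regularAction φ c) := fun c d hd =>
    (hf2 ⟨d, hd⟩ c.unop).1
  let ρ := quotientAction (regularAction φ) D hstab
  let δ : J ⧸ D →ₗ[k] (J ⧸ D) ⊗[k] J := D.liftQ (D.mkQ.rTensor J ∘ₗ comul) hf1
  have hδmk : δ ∘ₗ D.mkQ = D.mkQ.rTensor J ∘ₗ comul :=
    D.liftQ_mkQ _ (show D ≤ LinearMap.ker (D.mkQ.rTensor J ∘ₗ comul) from hf1)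
  have hassoc : (TensorProduct.assoc k (J ⧸ D) J J).toLinearMap ∘ₗ δ.rTensor J ∘ₗ δ =
      comul.lTensor (J ⧸ D) ∘ₗ δ := by
    have e : (TensorProduct.assoc k (J ⧸ D) J J).toLinearMap ∘ₗ (D.mkQ.rTensor J).rTensor J =
        D.mkQ.rTensor (J ⊗[k] J) ∘ₗ (TensorProduct.assoc k J J J).toLinearMap := by
      ext; rfl
    refine D.linearMap_qext ?_
    calc _ = (TensorProduct.assoc k (J ⧸ D) J J).toLinearMap ∘ₗ (δ ∘ₗ D.mkQ).rTensor J ∘ₗ comul := by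
          conv_lhs => rw [LinearMap.comp_assoc, LinearMap.comp_assoc, hδmk]
          rw [LinearMap.rTensor_comp, LinearMap.comp_assoc]
      _ = D.mkQ.rTensor (J ⊗[k] J) ∘ₗ (TensorProduct.assoc k J J J).toLinearMap ∘ₗ
          comul.rTensor J ∘ₗ comul := by
        rw [hδmk, LinearMap.rTensor_comp, ← LinearMap.comp_assoc, ← LinearMap.comp_assoc, e]
        simp only [LinearMap.comp_assoc]
      _ = _ := by
        rw [Coalgebra.coassoc, LinearMap.comp_assoc, hδmk, ← LinearMap.comp_assoc,
          ← LinearMap.comp_assoc, LinearMap.rTensor_comp_lTensor, LinearMap.lTensor_comp_rTensor]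
  have hcounit : counit.lTensor (J ⧸ D) ∘ₗ δ = (TensorProduct.mk k (J ⧸ D) k).flip 1 := by
    refine D.linearMap_qext ?_
    rw [LinearMap.comp_assoc, hδmk, ← LinearMap.comp_assoc, LinearMap.lTensor_comp_rTensor,
      ← LinearMap.rTensor_comp_lTensor, LinearMap.comp_assoc,
      Coalgebra.lTensor_counit_comp_comul]
    ext a
    simp
  have : Nontrivial (J ⧸ D) := Submodule.Quotient.nontrivial_iff.2 htop
  obtain ⟨m, g, hm, hg, hmg⟩ := exists_coact_eq_tmul_isGroupLikeElem δ hassoc hcounit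
  obtain ⟨x, rfl⟩ := D.mkQ_surjective m
  let o : K →ₗ[k] J := orbitMap (regularAction φ) x
  have ho : ∀ c, o c = x * φ c := fun c => rfl
  have hx : D.mkQ.rTensor J (comul (R := k) x) = D.mkQ x ⊗ₜ g := hmg
  have hδo : ∀ c, D.mkQ.rTensor J (comul (R := k) (o c)) = map (D.mkQ ∘ₗ o)
      (LinearMap.mulLeft k g ∘ₗ (φ : K →ₗ[k] J)) (comul (R := k) c) := by
    intro c
    have h1 : ∀ (a b : K) (y : J ⊗[k] J), D.mkQ.rTensor J (y * (φ a ⊗ₜ φ b)) =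
        map (ρ (.op a)) (LinearMap.mulRight k (φ b)) (D.mkQ.rTensor J y) := by
      intro a b y
      induction y with
      | zero => simp
      | add x y hx hy => simp only [add_mul, map_add, hx, hy]
      | tmul d e => rw [Algebra.TensorProduct.tmul_mul_tmul]; rfl
    have h2 : comul (R := k) (φ c) = map (φ : K →ₗ[k] J) (φ : K →ₗ[k] J) (comul (R := k) c) :=
      (LinearMap.congr_fun φ.map_comp_comul c).symm
    rw [ho, Bialgebra.comul_mul, h2]
    generalize comul (R := k) c = z
    induction z with
    | zero => simp
    | add x y hx hy => simp only [mul_add, map_add, hx, hy]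
    | tmul a b =>
      refine (h1 a b _).trans ?_
      rw [hx]
      rfl
  have hinj : Function.Injective (D.mkQ ∘ₗ o) :=
    orbitMap_injective_of_coact_eq φ hφ ρ δ hm hg hδo
  have hoinj : Function.Injective o := fun a b h => hinj (congrArg D.mkQ h)
  have hoD : ∀ c, o c ∈ D → c = 0 := fun c hc =>
    hinj (((Submodule.Quotient.mk_eq_zero D).2 hc).trans (map_zero _).symm)
  -- the map `x c ↦ ε(x) c` on `x K`
  let e := LinearEquiv.ofInjective o hoinj
  let f₁ : J →ₗ.[k] K := ⟨LinearMap.range o, counit (R := k) x • e.symm.toLinearMap⟩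
  have hf₁ : ∀ c (h : o c ∈ f₁.domain), f₁ ⟨o c, h⟩ = counit (R := k) x • c := by
    intro c h
    exact congrArg (counit (R := k) x • ·) (e.symm_apply_apply c)
  have H : ∀ (d : f.domain) (y : f₁.domain), (d : J) = y → f d = f₁ y := by
    rintro ⟨d, hd⟩ ⟨y, c, rfl⟩ rfl
    obtain rfl := hoD c hd
    have h0 : (⟨o 0, hd⟩ : f.domain) = 0 := Subtype.ext (map_zero o)
    exact ((congrArg f.toFun h0).trans (map_zero f.toFun)).trans
      ((hf₁ 0 _).trans (smul_zero _)).symm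
  have key : ∀ z ∈ (f.sup f₁ H).domain, ∃ (d : f.domain) (c : K), z = d + o c ∧
      ∀ h, f.sup f₁ H ⟨z, h⟩ = f d + counit (R := k) x • c := by
    intro z hz
    obtain ⟨d, hd, _, ⟨c, rfl⟩, rfl⟩ := Submodule.mem_sup.1 hz
    refine ⟨⟨d, hd⟩, c, rfl, fun h => ?_⟩
    exact (LinearPMap.sup_apply H ⟨d, hd⟩ ⟨o c, c, rfl⟩ ⟨_, h⟩ rfl).trans
      (congrArg (f ⟨d, hd⟩ + ·) (hf₁ c _))
  have hle : D ≤ (f.sup f₁ H).domain := le_sup_left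
  have hle₁ : LinearMap.range o ≤ (f.sup f₁ H).domain := le_sup_right
  refine ⟨f.sup f₁ H, ⟨fun z hz => ?_, ?_, ?_⟩, LinearPMap.left_le_sup _ _ H, fun h => hm ?_⟩
  · obtain ⟨d, c, rfl, -⟩ := key z hz
    rw [map_add, map_add, mkQ_rTensor_eq_zero_of_le hle (hf1 d d.2), zero_add]
    have e1 : (f.sup f₁ H).domain.mkQ = Submodule.factor hle ∘ₗ D.mkQ := by ext; rfl
    have e2 : Submodule.factor hle ∘ₗ D.mkQ ∘ₗ o = 0 := by
      ext c
      exact (Submodule.Quotient.mk_eq_zero _).2 (hle₁ ⟨c, rfl⟩)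
    rw [e1, LinearMap.rTensor_comp, LinearMap.comp_apply, hδo, LinearMap.rTensor,
      ← LinearMap.comp_apply, ← map_comp, e2, map_zero_left, LinearMap.zero_apply]
  · rintro ⟨z, hz⟩ b
    obtain ⟨d, c, rfl, hfz⟩ := key z hz
    obtain ⟨h, hfd⟩ := hf2 d b
    have hzb : ((d : J) + o c) * φ b = d * φ b + o (c * b) := by
      rw [ho, ho, add_mul, map_mul, mul_assoc]
    have hmem : ((d : J) + o c) * φ b ∈ (f.sup f₁ H).domain := by
      rw [hzb]
      exact add_mem (hle h) (hle₁ ⟨_, rfl⟩)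
    refine ⟨hmem, ?_⟩
    refine ((LinearPMap.sup_apply H ⟨_, h⟩ ⟨o (c * b), _, rfl⟩ ⟨_, hmem⟩ hzb.symm).trans
      ?_).trans (congrArg (· * b) (hfz hz)).symm
    rw [hfd, add_mul, smul_mul_assoc]
    exact congrArg (f d * b + ·) (hf₁ (c * b) _)
  · rintro ⟨z, hz⟩
    obtain ⟨d, c, rfl, hfz⟩ := key z hz
    have hc : counit (R := k) (φ c) = counit (R := k) c := LinearMap.congr_fun φ.counit_comp c
    rw [hfz, map_add, hf3, map_smul, map_add, ho, Bialgebra.counit_mul, hc, smul_eq_mul]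
  · refine (Submodule.Quotient.mk_eq_zero D).2 (h.1 (hle₁ ⟨1, ?_⟩))
    rw [ho, map_one, mul_one]

theorem exists_cointegral_of_isAlgClosed (φ : K →ₐc[k] J) (hφ : Function.Injective φ) :
    ∃ ψ : J →ₗ[k] K, (∀ a c, ψ (a * φ c) = ψ a * c) ∧
      ∀ a, counit (R := k) (ψ a) = counit (R := k) a := by
  obtain ⟨f, -, hf, hmax⟩ := zorn_le_nonempty₀ (partialCointegrals φ)
    (fun C hC hchain g hg => ⟨LinearPMap.sSup C hchain.directedOn,
      sSup_mem_partialCointegrals φ hC ⟨g, hg⟩ _, fun h hh => LinearPMap.le_sSup _ hh⟩)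
    ⊥ (bot_mem_partialCointegrals φ)
  have htop : f.domain = ⊤ := by
    by_contra htop
    obtain ⟨f', hf', hle, hnle⟩ := exists_lt_of_mem_partialCointegrals φ hφ hf htop
    exact hnle (hmax hf' hle)
  refine ⟨f.toFun ∘ₗ (LinearEquiv.ofTop _ htop).symm.toLinearMap, fun a c => ?_, fun a => ?_⟩
  · obtain ⟨h, e⟩ := hf.2.1 ⟨a, htop ▸ Submodule.mem_top⟩ c
    exact e
  · exact hf.2.2 ⟨a, htop ▸ Submodule.mem_top⟩

end Cointegral

/-- A cocommutative Hopf algebra `J` with an injective map `φ : K → J` of Hopf algebras admits a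
`K`-linear map `J → K` which preserves the counit. Over the algebraic closure `L` of `k` this is
`exists_cointegral_of_isAlgClosed`; any `k`-linear retraction of `k → L` brings the map down. -/
theorem exists_cointegral {k : Type v} [Field k] {K J : Type u} [Ring K] [HopfAlgebra k K] [Ring J]
    [HopfAlgebra k J] [IsCocomm k J] (φ : K →ₐc[k] J) (hφ : Function.Injective φ) :
    ∃ ψ : J →ₗ[k] K, (∀ a c, ψ (a * φ c) = ψ a * c) ∧
      ∀ a, counit (R := k) (ψ a) = counit (R := k) a := by
  let L := AlgebraicClosure k
  obtain ⟨ψ, h1, h2⟩ := exists_cointegral_of_isAlgClosed (k := L)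
    (Bialgebra.TensorProduct.map (BialgHom.id L L) φ)
    (Module.Flat.lTensor_preserves_injective_linearMap (M := L) (φ : K →ₗ[k] J) hφ)
  obtain ⟨r, hr⟩ := (Algebra.linearMap k L).exists_leftInverse_of_injective
    (LinearMap.ker_eq_bot.2 (algebraMap k L).injective)
  have hr1 : r 1 = 1 := by simpa using LinearMap.congr_fun hr 1
  let R : L ⊗[k] K →ₗ[k] K := (TensorProduct.lid k K).toLinearMap ∘ₗ r.rTensor K
  refine ⟨R ∘ₗ ψ.restrictScalars k ∘ₗ TensorProduct.mk k L J 1, fun a c => ?_, fun a => ?_⟩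
  · have h := h1 (1 ⊗ₜ a) (1 ⊗ₜ c)
    rw [Bialgebra.TensorProduct.map_tmul, Algebra.TensorProduct.tmul_mul_tmul] at h
    simp only [BialgHom.id_apply, mul_one] at h
    have hR : ∀ x : L ⊗[k] K, R (x * 1 ⊗ₜ c) = R x * c := by
      intro x
      induction x with
      | zero => simp
      | add x y hx hy => simp only [add_mul, map_add, hx, hy]
      | tmul a b => simp [R]
    exact (congrArg R h).trans (hR _)
  · have h := congrArg r (h2 (1 ⊗ₜ a))
    have hR : ∀ x : L ⊗[k] K, counit (R := k) (R x) = r (counit (R := L) x) := by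
      intro x
      induction x with
      | zero => simp
      | add x y hx hy => simp only [map_add, hx, hy]
      | tmul a b => simp [R, mul_comm]
    refine (hR _).trans (h.trans ?_)
    simp [hr1]

/-! ### Averaging a colinear section -/

section Antipode

open WithConv

variable {k : Type v} {K : Type u} [Field k] [Ring K] [HopfAlgebra k K] [IsCocomm k K]

/-- The antipode of a cocommutative Hopf algebra is comultiplicative: both sides are convolution
inverses of the coproduct. -/
theorem HopfAlgebra.comul_antipode_of_isCocomm (c : K) :
    comul (R := k) (HopfAlgebra.antipode k c) =
      map (HopfAlgebra.antipode k) (HopfAlgebra.antipode k) (comul (R := k) c) := by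
  have h1 : toConv (map (HopfAlgebra.antipode k) (HopfAlgebra.antipode k) ∘ₗ
      comul (R := k) (A := K)) * toConv (comul (R := k) (A := K)) = 1 := by
    have h := LinearMap.convMul_comp_coalgHom_distrib
      (toConv (map (HopfAlgebra.antipode k) (HopfAlgebra.antipode k)))
      (toConv (map LinearMap.id LinearMap.id)) (Coalgebra.comulCoalgHom k K)
    have h2 := TensorProduct.map_convMul_map (f := toConv (HopfAlgebra.antipode k (A := K)))
      (g := toConv (HopfAlgebra.antipode k (A := K))) (h := toConv LinearMap.id)
      (k := toConv LinearMap.id)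
    rw [LinearMap.antipode_mul_id] at h2
    simp only at h2
    rw [h2, map_id] at h
    apply WithConv.ext
    refine h.symm.trans ?_
    ext c
    have h3 := congrArg (map (Algebra.linearMap k K) (Algebra.linearMap k K ∘ₗ counit))
      (Coalgebra.rTensor_counit_comul (R := k) c)
    rw [LinearMap.rTensor, ← LinearMap.comp_apply, ← map_comp] at h3
    refine h3.trans ?_
    simp [LinearMap.convOne_def, Algebra.algebraMap_eq_smul_one, Algebra.TensorProduct.one_def]
  exact congrArg (fun f => f c) (left_inv_eq_right_inv h1 LinearMap.comul_right_inv).symm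

end Antipode

namespace ModComod

variable {k : Type v} [Field k] {K J : Type u} [Ring K] [HopfAlgebra k K] [Ring J] [Bialgebra k J]
  {φ : K →ₐc[k] J}

/-- The operator `m ↦ m c`, linear in `c`. -/
def right (M : ModComod φ) : K →ₗ[k] Module.End k M.carrier :=
  M.act.toLinearMap ∘ₗ (MulOpposite.opLinearEquiv k).toLinearMap

theorem right_apply (M : ModComod φ) (c : K) : M.right c = M.act (.op c) := rfl

theorem right_mul (M : ModComod φ) (a b : K) : M.right (a * b) = M.right b ∘ₗ M.right a := by
  simp only [right_apply, MulOpposite.op_mul, map_mul]; rfl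

theorem right_one (M : ModComod φ) : M.right 1 = LinearMap.id := by
  simp only [right_apply, MulOpposite.op_one, map_one]; rfl

variable {M N : ModComod φ}

/-- The map `x ⊗ y ↦ (n ↦ s(n S(x)) y)`. -/
def conjTensor (s : N.carrier →ₗ[k] M.carrier) :
    K ⊗[k] K →ₗ[k] N.carrier →ₗ[k] M.carrier :=
  TensorProduct.lift (LinearMap.mk₂ k
    (fun x y => M.right y ∘ₗ s ∘ₗ N.right (HopfAlgebra.antipode k x))
    (fun x x' y => by simp [LinearMap.comp_add]) (fun r x y => by simp [LinearMap.comp_smul])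
    (fun x y y' => by simp [LinearMap.add_comp]) (fun r x y => by simp [LinearMap.smul_comp]))

theorem conjTensor_tmul (s : N.carrier →ₗ[k] M.carrier) (x y : K) :
    conjTensor s (x ⊗ₜ y) = M.right y ∘ₗ s ∘ₗ N.right (HopfAlgebra.antipode k x) := rfl

/-- The adjoint action of `c` on a linear map `s`, namely `n ↦ s(n S(c₁)) c₂`. -/
def conj (s : N.carrier →ₗ[k] M.carrier) : K →ₗ[k] N.carrier →ₗ[k] M.carrier :=
  conjTensor s ∘ₗ comul

theorem conj_apply (s : N.carrier →ₗ[k] M.carrier) (c : K) :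
    conj s c = conjTensor s (comul c) := rfl

theorem conjTensor_mul_tmul (s : N.carrier →ₗ[k] M.carrier) (u : K ⊗[k] K) (x y : K) :
    conjTensor s (u * x ⊗ₜ y) =
      M.right y ∘ₗ conjTensor s u ∘ₗ N.right (HopfAlgebra.antipode k x) := by
  induction u with
  | zero => simp
  | add u v hu hv => simp only [add_mul, map_add, hu, hv, LinearMap.comp_add, LinearMap.add_comp]
  | tmul a b =>
    rw [Algebra.TensorProduct.tmul_mul_tmul, conjTensor_tmul, conjTensor_tmul,
      HopfAlgebra.antipode_mul_antidistrib, right_mul, right_mul]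
    rfl

/-- In Sweedler notation, `conj s (b c₂) (n c₁) = (conj s b n) c`. Indeed the left-hand side is
`s(n c₁ S(c₂) S(b₁)) b₂ c₃`, and `c₁ S(c₂) ⊗ c₃ = 1 ⊗ c`. -/
theorem conj_mul_comp_right (s : N.carrier →ₗ[k] M.carrier) (b c : K) (n : N.carrier) :
    TensorProduct.lift ((conj s ∘ₗ LinearMap.mulLeft k b).flip ∘ₗ orbitMap N.act n)
      (comul (R := k) c) = M.right c (conj s b n) := by
  let G : K ⊗[k] K →ₗ[k] M.carrier :=
    TensorProduct.lift (LinearMap.mk₂ k (fun a d => M.right d (conj s b (N.right a n)))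
    (fun x x' y => by simp) (fun r x y => by simp)
    (fun x y y' => by simp) (fun r x y => by simp))
  have h : ∀ w : K ⊗[k] K,
      TensorProduct.lift ((conj s ∘ₗ LinearMap.mulLeft k b).flip ∘ₗ orbitMap N.act n) w =
        G ((LinearMap.mul' k K ∘ₗ (HopfAlgebra.antipode k).lTensor K).rTensor K
          ((TensorProduct.assoc k K K K).symm (comul.lTensor K w))) := by
    intro w
    induction w with
    | zero => simp
    | add x y hx hy => simp only [map_add, hx, hy]
    | tmul x y =>
      have e : ∀ z : K ⊗[k] K, conjTensor s (comul b * z) (N.right x n) =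
          G ((LinearMap.mul' k K ∘ₗ (HopfAlgebra.antipode k).lTensor K).rTensor K
            ((TensorProduct.assoc k K K K).symm (x ⊗ₜ z))) := by
        intro z
        induction z with
        | zero => simp
        | add z w hz hw => simp only [mul_add, tmul_add, map_add, LinearMap.add_apply, hz, hw]
        | tmul z w =>
          rw [conjTensor_mul_tmul]
          simp only [TensorProduct.assoc_symm_tmul, LinearMap.rTensor_tmul, LinearMap.comp_apply,
            LinearMap.lTensor_tmul, LinearMap.mul'_apply]
          change _ = M.right w (conj s b (N.right (x * HopfAlgebra.antipode k z) n))
          rw [right_mul]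
          rfl
      rw [LinearMap.lTensor_tmul, ← e, ← Bialgebra.comul_mul]
      rfl
  rw [h, rTensor_mul_antipode_comul]
  change M.right c (conj s b (N.right 1 n)) = _
  rw [right_one]
  rfl

theorem linearMap_comp_conj (p : M ⟶ N) (s : N.carrier →ₗ[k] M.carrier)
    (hs : linearMap p ∘ₗ s = LinearMap.id) (c : K) :
    linearMap p ∘ₗ conj s c = counit (R := k) c • LinearMap.id := by
  have h : ∀ z : K ⊗[k] K, linearMap p ∘ₗ conjTensor s z =
      N.right (LinearMap.mul' k K ((HopfAlgebra.antipode k).rTensor K z)) := by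
    intro z
    induction z with
    | zero => simp
    | add x y hx hy => simp only [map_add, LinearMap.comp_add, hx, hy]
    | tmul x y =>
      have hp : linearMap p ∘ₗ M.right y = N.right y ∘ₗ linearMap p := p.2.1 (.op y)
      rw [conjTensor_tmul, ← LinearMap.comp_assoc, hp, LinearMap.comp_assoc,
        ← LinearMap.comp_assoc (N.right _) s, hs, LinearMap.id_comp, LinearMap.rTensor_tmul,
        LinearMap.mul'_apply, right_mul]
  rw [conj_apply, h, HopfAlgebra.mul_antipode_rTensor_comul_apply,
    Algebra.algebraMap_eq_smul_one, map_smul, right_one]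

/-- The right action `(m ⊗ j) (x ⊗ y) = m x ⊗ j φ(y)` of `K ⊗ K` on `M ⊗ J`. -/
def rightTensor (M : ModComod φ) : K ⊗[k] K →ₗ[k] Module.End k (M.carrier ⊗[k] J) :=
  TensorProduct.homTensorHomMap (RingHom.id k) M.carrier J M.carrier J ∘ₗ
    map M.right ((LinearMap.mul k J).flip ∘ₗ (φ : K →ₗ[k] J))

theorem coact_comp_right (M : ModComod φ) (c : K) :
    M.coact ∘ₗ M.right c = M.rightTensor (comul (R := k) c) ∘ₗ M.coact := by
  refine (M.coact_act (.op c)).trans (congrArg (· ∘ₗ M.coact) ?_)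
  simp only [diagonalAction, AlgHom.comp_apply, comulOp_apply]
  generalize comul (R := k) c = x
  induction x with
  | zero => simp
  | add x y hx hy => simp only [map_add, hx, hy]
  | tmul b d => rfl

/-- The coaction sends `s(n S(c₁)) c₂` to `s(n₀ S(c₂)) c₃ ⊗ n₁ S(c₁) c₄`, which by cocommutativity
of `K` is `s(n₀ S(c₁)) c₂ ⊗ n₁ S(c₃) c₄ = s(n₀ S(c₁)) c₂ ⊗ n₁`. -/
theorem isColinear_conj [IsCocomm k K] {s : N.carrier →ₗ[k] M.carrier} (hs : IsColinear s)
    (c : K) : IsColinear (conj s c) := by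
  -- `E ((a ⊗ d) ⊗ (b ⊗ e))` is the map `n ⊗ j ↦ s(n S(a)) d ⊗ j S(b) e`
  let E : (K ⊗[k] K) ⊗[k] (K ⊗[k] K) →ₗ[k] N.carrier ⊗[k] J →ₗ[k] M.carrier ⊗[k] J :=
    TensorProduct.homTensorHomMap (RingHom.id k) N.carrier J M.carrier J ∘ₗ
      map (conjTensor s) ((LinearMap.mul k J).flip ∘ₗ (φ : K →ₗ[k] J) ∘ₗ LinearMap.mul' k K ∘ₗ
        (HopfAlgebra.antipode k).rTensor K)
  have h1 : ∀ z w : K ⊗[k] K, M.rightTensor w ∘ₗ s.rTensor J ∘ₗ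
      N.rightTensor (map (HopfAlgebra.antipode k) (HopfAlgebra.antipode k) z) =
      E (TensorProduct.AlgebraTensorModule.tensorTensorTensorComm k k k k K K K K (z ⊗ₜ w)) := by
    intro z w
    induction z with
    | zero => simp
    | add z z' hz hz' => simp only [map_add, add_tmul, LinearMap.comp_add, hz, hz']
    | tmul a b =>
      induction w with
      | zero => simp
      | add z z' hz hz' => simp only [map_add, tmul_add, LinearMap.add_comp, hz, hz']
      | tmul d e =>
        refine TensorProduct.ext' fun n j => ?_
        change M.right d (s (N.right (HopfAlgebra.antipode k a) n)) ⊗ₜ[k]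
            (j * φ (HopfAlgebra.antipode k b) * φ e) =
          M.right d (s (N.right (HopfAlgebra.antipode k a) n)) ⊗ₜ[k]
            (j * φ (HopfAlgebra.antipode k b * e))
        rw [map_mul, mul_assoc]
  have h2 : ∀ z : K ⊗[k] K, M.coact ∘ₗ conjTensor s z =
      E (TensorProduct.AlgebraTensorModule.tensorTensorTensorComm k k k k K K K K
        (map comul comul z)) ∘ₗ N.coact := by
    intro z
    induction z with
    | zero => simp
    | add z z' hz hz' => simp only [map_add, LinearMap.comp_add, LinearMap.add_comp, hz, hz']
    | tmul x y =>
      have hs' : M.coact ∘ₗ s = s.rTensor J ∘ₗ N.coact := hs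
      rw [map_tmul, ← h1, conjTensor_tmul, ← LinearMap.comp_assoc, coact_comp_right,
        LinearMap.comp_assoc, ← LinearMap.comp_assoc (N.right _) s, hs', LinearMap.comp_assoc,
        coact_comp_right, HopfAlgebra.comul_antipode_of_isCocomm]
      rfl
  -- the coproduct of a cocommutative coalgebra is a coalgebra map
  have h3 : TensorProduct.AlgebraTensorModule.tensorTensorTensorComm k k k k K K K K
      (map comul comul (comul (R := k) c)) = map comul comul (comul (R := k) c) :=
    (LinearMap.congr_fun (Coalgebra.comulCoalgHom k K).map_comp_comul c).symm
  have h4 : ∀ z : K ⊗[k] K, E (map comul comul z) =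
      (conj s (TensorProduct.rid k K (counit.lTensor K z))).rTensor J := by
    intro z
    induction z with
    | zero => simp
    | add z z' hz hz' => simp only [map_add, LinearMap.rTensor_add, hz, hz']
    | tmul x y =>
      refine TensorProduct.ext' fun n j => ?_
      change conj s x n ⊗ₜ[k] (j * φ (LinearMap.mul' k K
        ((HopfAlgebra.antipode k).rTensor K (comul y)))) = _
      rw [HopfAlgebra.mul_antipode_rTensor_comul_apply, Algebra.algebraMap_eq_smul_one, map_smul,
        map_one, mul_smul_comm, mul_one]
      simp [smul_tmul']
  rw [IsColinear, conj_apply, h2, h3, h4, Coalgebra.lTensor_counit_comul]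
  simp [conj_apply]

/-- The map `n ⊗ a ↦ s(n S(ψ(a)₁)) ψ(a)₂`. -/
def averageTensor (ψ : J →ₗ[k] K) (s : N.carrier →ₗ[k] M.carrier) :
    N.carrier ⊗[k] J →ₗ[k] M.carrier :=
  TensorProduct.lift (conj s ∘ₗ ψ).flip

theorem averageTensor_tmul (ψ : J →ₗ[k] K) (s : N.carrier →ₗ[k] M.carrier) (n : N.carrier)
    (a : J) : averageTensor ψ s (n ⊗ₜ a) = conj s (ψ a) n := rfl

/-- The average `n ↦ s(n₀ S(ψ(n₁)₁)) ψ(n₁)₂` of a linear map `s` over `ψ : J → K`. -/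
def average (ψ : J →ₗ[k] K) (s : N.carrier →ₗ[k] M.carrier) : N.carrier →ₗ[k] M.carrier :=
  averageTensor ψ s ∘ₗ N.coact

theorem average_comp_act {ψ : J →ₗ[k] K} (hψ : ∀ a c, ψ (a * φ c) = ψ a * c)
    (s : N.carrier →ₗ[k] M.carrier) (c : Kᵐᵒᵖ) :
    average ψ s ∘ₗ N.act c = M.act c ∘ₗ average ψ s := by
  obtain ⟨c, rfl⟩ := MulOpposite.op_surjective c
  have h : ∀ x, averageTensor ψ s (diagonalAction N.act (regularAction φ) (.op c) x) =
      M.right c (averageTensor ψ s x) := by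
    intro x
    induction x with
    | zero => simp
    | add x y hx hy => simp only [map_add, hx, hy]
    | tmul n a =>
      rw [diagonalAction_tmul, averageTensor_tmul, ← conj_mul_comp_right]
      generalize comul (R := k) c = z
      induction z with
      | zero => simp
      | add x y hx hy => simp only [map_add, hx, hy]
      | tmul x y =>
        change conj s (ψ (a * φ y)) _ = conj s (ψ a * y) _
        rw [hψ]
  rw [average, LinearMap.comp_assoc, N.coact_act]
  exact LinearMap.ext fun n => h _

theorem isColinear_average [IsCocomm k K] [IsCocomm k J] (ψ : J →ₗ[k] K)
    {s : N.carrier →ₗ[k] M.carrier} (hs : IsColinear s) : IsColinear (average ψ s) := by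
  have h1 : M.coact ∘ₗ averageTensor ψ s = (averageTensor ψ s).rTensor J ∘ₗ
      (TensorProduct.rightComm k N.carrier J J).toLinearMap ∘ₗ N.coact.rTensor J := by
    refine TensorProduct.ext' fun n a => ?_
    refine (LinearMap.congr_fun (isColinear_conj hs (ψ a)) n).trans ?_
    simp only [LinearMap.comp_apply, LinearMap.rTensor_tmul]
    generalize N.coact n = x
    induction x with
    | zero => simp
    | add x y hx hy => simp only [map_add, add_tmul, hx, hy]
    | tmul n b => rfl
  -- by cocommutativity of `J`, `n₀ ⊗ n₁ ⊗ n₂` is symmetric in its last two factors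
  have h2 : (TensorProduct.rightComm k N.carrier J J).toLinearMap ∘ₗ N.coact.rTensor J ∘ₗ
      N.coact = N.coact.rTensor J ∘ₗ N.coact := by
    have h3 : (TensorProduct.assoc k N.carrier J J).toLinearMap ∘ₗ
        (TensorProduct.rightComm k N.carrier J J).toLinearMap =
        (TensorProduct.comm k J J).toLinearMap.lTensor N.carrier ∘ₗ
          (TensorProduct.assoc k N.carrier J J).toLinearMap := by
      ext; rfl
    have h4 := congrArg ((TensorProduct.comm k J J).toLinearMap.lTensor N.carrier ∘ₗ ·) N.coassoc
    simp only [← LinearMap.comp_assoc, ← LinearMap.lTensor_comp, IsCocomm.comm_comp_comul] at h4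
    rw [← h3] at h4
    refine LinearMap.ext fun n => (TensorProduct.assoc k N.carrier J J).injective ?_
    exact (LinearMap.congr_fun h4 n).trans (LinearMap.congr_fun N.coassoc n).symm
  rw [IsColinear, average, ← LinearMap.comp_assoc, h1, LinearMap.comp_assoc, LinearMap.comp_assoc,
    h2, LinearMap.rTensor_comp, LinearMap.comp_assoc]

theorem linearMap_comp_average (p : M ⟶ N) {s : N.carrier →ₗ[k] M.carrier}
    (hs : linearMap p ∘ₗ s = LinearMap.id) {ψ : J →ₗ[k] K}
    (hψ : ∀ a, counit (R := k) (ψ a) = counit (R := k) a) :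
    linearMap p ∘ₗ average ψ s = LinearMap.id := by
  have h : linearMap p ∘ₗ averageTensor ψ s =
      (TensorProduct.rid k N.carrier).toLinearMap ∘ₗ counit.lTensor N.carrier := by
    refine TensorProduct.ext' fun n a => ?_
    refine (LinearMap.congr_fun (linearMap_comp_conj p s hs (ψ a)) n).trans ?_
    simp [hψ]
  rw [average, ← LinearMap.comp_assoc, h, LinearMap.comp_assoc, N.counit_coact]
  ext n
  simp

end ModComod

/-- A Maschke-type theorem: averaging a colinear section over a cointegral `ψ : J → K` makes it
`K`-linear as well. -/
theorem ModComod.exists_section {k : Type v} [Field k] {K J : Type u} [Ring K] [HopfAlgebra k K]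
    [IsCocomm k K] [Ring J] [HopfAlgebra k J] [IsCocomm k J] {φ : K →ₐc[k] J}
    (hφ : Function.Injective φ) {M N : ModComod φ} (p : M ⟶ N) {s : N.carrier →ₗ[k] M.carrier}
    (hs : IsColinear s) (hps : linearMap p ∘ₗ s = LinearMap.id) : ∃ t : N ⟶ M, t ≫ p = 𝟙 N := by
  obtain ⟨ψ, hψ, hψε⟩ := exists_cointegral φ hφ
  exact ⟨⟨average ψ s, average_comp_act hψ s, isColinear_average ψ hs⟩,
    Subtype.ext (linearMap_comp_average p hps hψε)⟩

/-- A short complex in `Mod_K^J` which is exact on underlying vector spaces splits as soon as its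
second map has a section `t`: the corestriction of `id - t g` to the image of `f` is the
retraction. -/
theorem ModComod.nonempty_splitting {k : Type v} [Field k] {K J : Type u} [Ring K] [Bialgebra k K]
    [Ring J] [Bialgebra k J] {φ : K →ₐc[k] J} (S : ShortComplex (ModComod φ))
    (hf : Function.Injective (linearMap S.f))
    (hexact : Function.Exact (linearMap S.f) (linearMap S.g)) {t : S.X₃ ⟶ S.X₂}
    (ht : t ≫ S.g = 𝟙 _) : Nonempty S.Splitting := by
  have ht' : linearMap S.g ∘ₗ linearMap t = LinearMap.id := congrArg Subtype.val ht
  let q : S.X₂ ⟶ S.X₂ := 𝟙 _ - S.g ≫ t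
  have hq : ∀ x, linearMap q x ∈ LinearMap.range (linearMap S.f) := by
    intro x
    refine (hexact _).1 ?_
    change linearMap S.g (x - linearMap t (linearMap S.g x)) = 0
    rw [map_sub, ← LinearMap.comp_apply _ (linearMap t), ht', LinearMap.id_apply, sub_self]
  let e := LinearEquiv.ofInjective (linearMap S.f) hf
  let r : S.X₂.carrier →ₗ[k] S.X₁.carrier :=
    e.symm.toLinearMap ∘ₗ (linearMap q).codRestrict _ hq
  have hr : linearMap S.f ∘ₗ r = linearMap q :=
    LinearMap.ext fun x => congrArg Subtype.val (e.apply_symm_apply ⟨linearMap q x, hq x⟩)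
  have hcancel : ∀ {a b : S.X₂.carrier →ₗ[k] S.X₁.carrier},
      linearMap S.f ∘ₗ a = linearMap S.f ∘ₗ b → a = b := fun h =>
    LinearMap.ext fun x => hf (LinearMap.congr_fun h x)
  have hfJ : Function.Injective ((linearMap S.f).rTensor J) :=
    Module.Flat.rTensor_preserves_injective_linearMap _ hf
  let R : S.X₂ ⟶ S.X₁ := ⟨r, fun c => hcancel <| by
      have h1 : linearMap S.f ∘ₗ S.X₁.act c = S.X₂.act c ∘ₗ linearMap S.f := S.f.2.1 c
      have h2 : linearMap q ∘ₗ S.X₂.act c = S.X₂.act c ∘ₗ linearMap q := q.2.1 c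
      rw [← LinearMap.comp_assoc, hr, ← LinearMap.comp_assoc, h1, LinearMap.comp_assoc, hr, h2], by
      have h1 : S.X₂.coact ∘ₗ linearMap S.f = (linearMap S.f).rTensor J ∘ₗ S.X₁.coact := S.f.2.2
      have h2 : S.X₂.coact ∘ₗ linearMap q = (linearMap q).rTensor J ∘ₗ S.X₂.coact := q.2.2
      refine LinearMap.ext fun x => hfJ (LinearMap.congr_fun ?_ x :
        ((linearMap S.f).rTensor J ∘ₗ S.X₁.coact ∘ₗ r) x =
          ((linearMap S.f).rTensor J ∘ₗ r.rTensor J ∘ₗ S.X₂.coact) x)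
      rw [← LinearMap.comp_assoc, ← h1, LinearMap.comp_assoc, hr, h2, ← hr,
        LinearMap.rTensor_comp, LinearMap.comp_assoc]⟩
  refine ⟨{ r := R, s := t, s_g := ht, f_r := ?_, id := ?_ }⟩
  · refine Subtype.ext (LinearMap.ext fun x => hf ?_)
    change (linearMap S.f ∘ₗ r) (linearMap S.f x) = linearMap S.f x
    rw [hr]
    change linearMap S.f x - linearMap t (linearMap S.g (linearMap S.f x)) = linearMap S.f x
    rw [hexact.apply_apply_eq_zero, map_zero, sub_zero]
  · have h : R ≫ S.f = q := Subtype.ext hr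
    rw [h]
    exact sub_add_cancel _ _

/-! ### The sequence of odd primitive elements -/

namespace HopfSuperalgebra.Hom

variable {k : Type v} [Field k] {B A : Type u} [Ring B] [Algebra k B] [HopfSuperalgebra k B]
  [Ring A] [Algebra k A] [HopfSuperalgebra k A] (ι : Hom k B A)

theorem evenMap_injective (hι : Function.Injective ι.algHom) : Function.Injective ι.evenMap :=
  fun _ _ h => Subtype.ext (hι (congrArg Subtype.val h))

theorem oddMap_injective (hι : Function.Injective ι.algHom) : Function.Injective ι.oddMap :=
  fun _ _ h => Subtype.ext (hι (congrArg Subtype.val h))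

/-- A linear section of the projection `V_A → V_A / V_B`, tensored with `J`, is colinear. -/
theorem exists_isColinear_section_oddSequence_g :
    ∃ s : ι.oddSequence.X₃.carrier →ₗ[k] ι.oddSequence.X₂.carrier,
      ModComod.IsColinear (M := ι.oddSequence.X₃) (N := ι.oddSequence.X₂) s ∧
      ModComod.linearMap ι.oddSequence.g ∘ₗ s = LinearMap.id := by
  obtain ⟨s, hs⟩ := (LinearMap.range ι.oddMap).mkQ.exists_rightInverse_of_surjective
    (LinearMap.range_eq_top.2 (Submodule.mkQ_surjective _))
  refine ⟨s.lTensor (evenPart k A), ?_, ?_⟩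
  · refine TensorProduct.ext' fun a w => ?_
    change TensorProduct.rightComm k _ _ _ (comul a ⊗ₜ s w) =
      (s.lTensor (evenPart k A)).rTensor (evenPart k A)
        (TensorProduct.rightComm k _ _ _ (comul a ⊗ₜ w))
    generalize comul (R := k) a = x
    induction x with
    | zero => simp
    | add x y hx hy => simp only [add_tmul, map_add, hx, hy]
    | tmul d e => rfl
  · change (LinearMap.range ι.oddMap).mkQ.lTensor (evenPart k A) ∘ₗ
      s.lTensor (evenPart k A) = LinearMap.id
    rw [← LinearMap.lTensor_comp, hs, LinearMap.lTensor_id]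

end HopfSuperalgebra.Hom

end

theorem lemma4p1 {k : Type v} [Field k] (hk : ringChar k ≠ 2)
    {𝕂 𝕁 : Type u} [Ring 𝕂] [Algebra k 𝕂] [HopfSuperalgebra k 𝕂]
    [Ring 𝕁] [Algebra k 𝕁] [HopfSuperalgebra k 𝕁]
    (ι : HopfSuperalgebra.Hom k 𝕂 𝕁) (hι : Function.Injective ι.algHom) :
    Nonempty ι.oddSequence.Splitting ∧
      ∀ (M N : ModComod ι.evenMap) (p : M ⟶ N),
        (∃ s : N.carrier →ₗ[k] M.carrier, ModComod.IsColinear s ∧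
          ModComod.linearMap p ∘ₗ s = LinearMap.id) →
        ∃ t : N ⟶ M, CategoryTheory.CategoryStruct.comp t p =
          CategoryTheory.CategoryStruct.id N := by
  have hsection : ∀ (M N : ModComod ι.evenMap) (p : M ⟶ N),
      (∃ s : N.carrier →ₗ[k] M.carrier, ModComod.IsColinear s ∧
        ModComod.linearMap p ∘ₗ s = LinearMap.id) →
      ∃ t : N ⟶ M, CategoryTheory.CategoryStruct.comp t p =
        CategoryTheory.CategoryStruct.id N := by
    rintro M N p ⟨s, hs, hps⟩
    exact ModComod.exists_section (ι.evenMap_injective hι) p hs hps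
  refine ⟨?_, hsection⟩
  obtain ⟨t, ht⟩ := hsection _ _ ι.oddSequence.g ι.exists_isColinear_section_oddSequence_g
  refine ModComod.nonempty_splitting ι.oddSequence ?_ ?_ ht
  · exact Module.Flat.lTensor_preserves_injective_linearMap (M := HopfSuperalgebra.evenPart k 𝕁)
      ι.oddMap (ι.oddMap_injective hι)
  · exact lTensor_exact (HopfSuperalgebra.evenPart k 𝕁)
      (LinearMap.exact_map_mkQ_range ι.oddMap) (Submodule.mkQ_surjective _)
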